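/- Let $d, K \in \mathbb N$ and $\varepsilon>0$, let $C(x,y)=\|x-y\|^2$ be the squared Euclidean cost on $\mathbb R^d$, and let $\mathcal K(x,y)=e^{-C(x,y)/\varepsilon}$. Let $\mathcal G(\mathbb R^d)$ be the set of sub-Gaussian probability measures on $\mathbb R^d$, i.e. those $\mu$ with $\int e^{q\|x\|^2}\,d\mu(x)<\infty$ for some $q>0$. For $\alpha,\beta\in\mathcal G(\mathbb R^d)$ let $$\mathrm{OT}_\varepsilon^{\otimes}(\alpha,\beta)=\inf_{\pi}\int C\,d\pi+\varepsilon\,\mathrm{KL}(\pi\,|\,\alpha\otimes\beta),$$ the infimum being over all couplings $\pi$ of $\alpha$ and $\beta$, and let $$S_\varepsilon(\alpha,\beta)=\mathrm{OT}_\varepsilon^{\otimes}(\alpha,\beta)-\tfrac12\bigl(\mathrm{OT}_\varepsilon^{\otimes}(\alpha,\alpha)+\mathrm{OT}_\varepsilon^{\otimes}(\beta,\beta)\bigr).$$ Let $\alpha_1,\dots,\alpha_K\in\mathcal G(\mathbb R^d)$, let $w_1,\dots,w_K\ge 0$ with $\sum_k w_k=1$, and let $\alpha\in\mathcal G(\mathbb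 R^d)$. (1) $\alpha$ minimizes $\sum_{k} w_k\,\mathrm{OT}_\varepsilon^{\otimes}(\alpha_k,\cdot)$ over $\mathcal G(\mathbb R^d)$ if and only if there are functions $f_1,\dots,f_K,g_1,\dots,g_K:\mathbb R^d\to\mathbb R$ such that, for every $k$ and every point $x \in \mathbb R^d$, $$e^{f_k(x)/\varepsilon}\int \mathcal K(x,y)\,e^{g_k(y)/\varepsilon}\,d\alpha(y)=1,\qquad e^{g_k(x)/\varepsilon}\int \mathcal K(y,x)\,e^{f_k(y)/\varepsilon}\,d\alpha_k(y)=1,$$ and such that, for every $\beta\in\mathcal G(\mathbb R^d)$, $\sum_k w_kg_k$ is integrable with respect to $\alpha$ and $\beta$ and $$\Bigl\langle \sum_{k} w_k g_k,\ \beta-\alpha\Bigr\rangle:=\int \sum_k w_kg_k\,d\beta-\int \sum_k w_kg_k\,d\alpha\ \ge 0.$$ (2) $\alpha$ minimizes $\sum_{k} w_k\,S_\varepsilon(\alpha_k,\cdot)$ over $\mathcal G(\mathbb R^d)$ if and only if there are functions $f_1,\dots,f_K,g_1,\dots,g_K,h:\mathbb R^d\to\mathbb R$ such that the equations displayed in (1)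 hold for every $k$ and every $x\in\mathbb R^d$, such that $$e^{h(x)/\varepsilon}\int \mathcal K(x,y)\,e^{h(y)/\varepsilon}\,d\alpha(y)=1\qquad\text{for every } x\in\mathbb R^d,$$ and such that, for every $\beta\in\mathcal G(\mathbb R^d)$, $\sum_k w_kg_k-h$ is integrable with respect to $\alpha$ and $\beta$ and $\bigl\langle \sum_{k} w_k g_k-h,\ \beta-\alpha\bigr\rangle\ge 0$. -/

import Mathlib

open MeasureTheory

noncomputable section

namespace SinkhornBarycenter

/-- Probability measures on `ℝ^d` with its Euclidean norm. -/
abbrev Prob (d : ℕ) : Type := ProbabilityMeasure (EuclideanSpace ℝ (Fin d))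

/-- The quadratic ground cost `C(x, y) = ‖x - y‖²`. -/
def cost {d : ℕ} (x y : EuclideanSpace ℝ (Fin d)) : ℝ := ‖x - y‖ ^ 2

/-- The set `𝒢(ℝ^d)` of sub-Gaussian probability measures: those with a finite moment
`∫ exp (q ‖x‖²) dμ` for some `q > 0` (no centering, and no common value of `q`). -/
def subGaussian (d : ℕ) : Set (Prob d) :=
  {μ | ∃ q : ℝ, 0 < q ∧
    Integrable (fun x => Real.exp (q * ‖x‖ ^ 2)) (μ : Measure (EuclideanSpace ℝ (Fin d)))}

/-- The set of couplings (transport plans) of `α` and `β`. -/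
def couplings {d : ℕ} (α β : Prob d) :
    Set (Measure (EuclideanSpace ℝ (Fin d) × EuclideanSpace ℝ (Fin d))) :=
  {π | π.map Prod.fst = α ∧ π.map Prod.snd = β}

/-- Entropic optimal transport with the product of the marginals as reference measure,
`inf_π ∫ C dπ + ε KL(π | α ⊗ β)` over the couplings `π` of `α` and `β`. -/
def entropicCost {d : ℕ} (ε : ℝ) (α β : Prob d) : ENNReal :=
  ⨅ π ∈ couplings α β,
    (∫⁻ p, ENNReal.ofReal (cost p.1 p.2) ∂π) +
      ENNReal.ofReal ε * InformationTheory.klDiv π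
        ((α : Measure (EuclideanSpace ℝ (Fin d))).prod
          (β : Measure (EuclideanSpace ℝ (Fin d))))

/-- `OT_ε^⊗(α, β)` as a real number; it is finite on sub-Gaussian measures, since the coupling
`α ⊗ β` has finite cost and zero relative entropy. -/
def OT {d : ℕ} (ε : ℝ) (α β : Prob d) : ℝ := (entropicCost ε α β).toReal

/-- The Sinkhorn divergence
`S_ε(α, β) = OT_ε^⊗(α, β) - (OT_ε^⊗(α, α) + OT_ε^⊗(β, β)) / 2`. -/
def sinkhornDiv {d : ℕ} (ε : ℝ) (α β : Prob d) : ℝ :=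
  OT ε α β - (OT ε α α + OT ε β β) / 2

/-- `α` minimizes `∑ k, w k * D (a k) α` over the sub-Gaussian probability measures. -/
def IsBarycenter {d K : ℕ} (D : Prob d → Prob d → ℝ) (w : Fin K → ℝ) (a : Fin K → Prob d)
    (α : Prob d) : Prop :=
  α ∈ subGaussian d ∧ IsMinOn (fun β => ∑ k, w k * D (a k) β) (subGaussian d) α

/-- `𝒦(φ · μ)(x) = ∫ K(x, y) φ(y) dμ(y)` with `K = exp (-C / ε)`. -/
def kernelOp {d : ℕ} (ε : ℝ) (φ : EuclideanSpace ℝ (Fin d) → ℝ) (μ : Prob d)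
    (x : EuclideanSpace ℝ (Fin d)) : ℝ :=
  ∫ y, Real.exp (-cost x y / ε) * φ y ∂(μ : Measure (EuclideanSpace ℝ (Fin d)))

/-- The transposed operator `𝒦ᵀ(φ · μ)(y) = ∫ K(x, y) φ(x) dμ(x)`. -/
def kernelOpT {d : ℕ} (ε : ℝ) (φ : EuclideanSpace ℝ (Fin d) → ℝ) (μ : Prob d)
    (y : EuclideanSpace ℝ (Fin d)) : ℝ :=
  ∫ x, Real.exp (-cost x y / ε) * φ x ∂(μ : Measure (EuclideanSpace ℝ (Fin d)))

/-- The Sinkhorn equations for `(α, β)`, required at every point of `ℝ^d`. As the right-hand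
sides are `1`, the integrals cannot be those of non-integrable functions. -/
def SinkhornEqs {d : ℕ} (ε : ℝ) (α β : Prob d) (f g : EuclideanSpace ℝ (Fin d) → ℝ) : Prop :=
  (∀ x, Real.exp (f x / ε) * kernelOp ε (fun y => Real.exp (g y / ε)) β x = 1) ∧
  (∀ y, Real.exp (g y / ε) * kernelOpT ε (fun x => Real.exp (f x / ε)) α y = 1)

/-- The autocorrelation equation `e^{h/ε} 𝒦(e^{h/ε} α) = 1` at every point of `ℝ^d`. -/
def AutoSinkhornEq {d : ℕ} (ε : ℝ) (α : Prob d) (h : EuclideanSpace ℝ (Fin d) → ℝ) : Prop :=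
  ∀ x, Real.exp (h x / ε) * kernelOp ε (fun y => Real.exp (h y / ε)) α x = 1

/-- `⟨u, β - α⟩ ≥ 0` for every sub-Gaussian `β`, where `⟨u, μ⟩ = ∫ u dμ` is finite. -/
def NonnegPairing {d : ℕ} (u : EuclideanSpace ℝ (Fin d) → ℝ) (α : Prob d) : Prop :=
  Integrable u (α : Measure (EuclideanSpace ℝ (Fin d))) ∧
  ∀ β ∈ subGaussian d,
    Integrable u (β : Measure (EuclideanSpace ℝ (Fin d))) ∧
    0 ≤ (∫ x, u x ∂(β : Measure (EuclideanSpace ℝ (Fin d)))) -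
      ∫ x, u x ∂(α : Measure (EuclideanSpace ℝ (Fin d)))

end SinkhornBarycenter

end

/-!
For `c ≥ 0` consider the objective `F(β) = ∑ k, w k * OT_ε(a k, β) - (c / 2) OT_ε(β, β)`; the two
halves of the theorem are `c = 0` and, up to a constant, `c = 1`. Minimality of `α` is read off from
the directional derivatives of `F` at `α`, which Schrödinger potentials compute.

*Existence.* The Sinkhorn equations for sub-Gaussian `α, β` say that `h = exp (-f / ε)` is a fixed
point of the isotone map `Ω(h) = 𝒦((𝒦ᵀ(h⁻¹ α))⁻¹ β)`. By Tonelli's theorem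
`∫ Ω(h) / h dα = 1`, so a sub- or supersolution is a solution `α`-almost everywhere. Fortet's
increasing iteration `h ↦ max (Ω(h), barrier)` from a Gaussian barrier either becomes stationary or
converges to a supersolution (`exists_fortet_fixedPoint`). All functions take values in `[0, ∞]`,
and no compactness is used. The equations give measurability and quadratic growth of all
potentials (`SinkhornEqs.potentials`), which makes them integrable against sub-Gaussian measures.
The potentials of `(α, α)` differ by a constant, so that a symmetric one exists
(`exists_symmetric_potential`).

*Sufficiency.* The second Sinkhorn equation holds at every point, so the Gibbs density of the
potentials of `(a k, α)` has mass one against `a k ⊗ β` for every `β`. Weak duality then gives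
`OT_ε(a k, β) ≥ OT_ε(a k, α) + ⟨g k, β - α⟩` (`Potentials.le_OT`, `Potentials.OT_eq`). For the
self-transport term, positive definiteness of the Gaussian kernel and Jensen's inequality give
`OT_ε(β, β) / 2 ≤ OT_ε(α, α) / 2 + ⟨h, β - α⟩` (`Potentials.integral_symmetric_le`). Hence
`F(β) ≥ F(α) + ⟨∑ k, w k * g k - c h, β - α⟩`.

*Necessity.* It suffices to show `∫ u dα ≤ u(y)` at every point `y`, for
`u = ∑ k, w k * g k - c h`. Move the mass `t` from `α` restricted to a ball to the point `y`. An
explicit competitor, whose chi-square divergence from the Gibbs density is `o(t)`, bounds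
`OT_ε(a k, ·)` from above to first order (`Potentials.exists_OT_perturb_le`), and weak duality
bounds the self-transport term from below up to `O(t²)` (`Potentials.le_OT_self_perturb`). Letting
`t → 0` and then the ball grow gives the claim (`integral_le_of_objective_le`).
-/

noncomputable section

namespace SinkhornBarycenter

open Set Filter InformationTheory
open scoped ENNReal Topology

/-- The Euclidean space `ℝ^d`. -/
abbrev Euc (d : ℕ) : Type := EuclideanSpace ℝ (Fin d)

variable {d : ℕ} {ε : ℝ}

/-! ### The Gaussian kernel and its two-sided bounds -/

/-- The Gaussian kernel `exp (-C / ε)`, valued in `[0, ∞]`. -/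
def gker (ε : ℝ) (x y : Euc d) : ℝ≥0∞ := ENNReal.ofReal (Real.exp (-cost x y / ε))

/-- The kernel operator `φ ↦ ∫ exp (-C(x, y) / ε) φ(y) dμ(y)` on `[0, ∞]`-valued functions, where
monotone convergence and Tonelli's theorem need no integrability. As the kernel is symmetric, it
stands for the transposed operator as well. -/
def gop (ε : ℝ) (μ : Measure (Euc d)) (φ : Euc d → ℝ≥0∞) (x : Euc d) : ℝ≥0∞ :=
  ∫⁻ y, gker ε x y * φ y ∂μ

lemma cost_comm (x y : Euc d) : cost x y = cost y x := by
  simp only [cost, norm_sub_rev]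

lemma gker_comm (x y : Euc d) : gker ε x y = gker ε y x := by
  simp only [gker, cost_comm]

lemma continuous_cost : Continuous fun p : Euc d × Euc d => cost p.1 p.2 := by
  unfold cost; fun_prop

lemma measurable_cost : Measurable fun p : Euc d × Euc d => cost p.1 p.2 :=
  continuous_cost.measurable

@[fun_prop]
lemma measurable_gker_comp {X : Type*} [MeasurableSpace X] {f g : X → Euc d} (hf : Measurable f)
    (hg : Measurable g) : Measurable fun x => gker ε (f x) (g x) := by
  unfold gker cost; fun_prop

lemma gker_ne_zero (x y : Euc d) : gker ε x y ≠ 0 := by simp [gker, Real.exp_pos]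

lemma gker_ne_top (x y : Euc d) : gker ε x y ≠ ∞ := by simp [gker]

lemma measurable_gop (μ : Measure (Euc d)) [SFinite μ] {φ : Euc d → ℝ≥0∞} (hφ : Measurable φ) :
    Measurable (gop ε μ φ) := by
  unfold gop
  exact Measurable.lintegral_prod_right' (f := fun p : Euc d × Euc d => gker ε p.1 p.2 * φ p.2)
    (by fun_prop)

lemma gop_mono {μ : Measure (Euc d)} {φ ψ : Euc d → ℝ≥0∞} (h : φ ≤ ψ) (x : Euc d) :
    gop ε μ φ x ≤ gop ε μ ψ x :=
  lintegral_mono fun y => mul_le_mul_right (h y) _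

lemma neg_cost_le_of_norm_le (x : Euc d) {y : Euc d} {R : ℝ} (hy : ‖y‖ ≤ R) :
    -(‖x‖ + R) ^ 2 ≤ -cost x y := by
  have h1 : ‖x - y‖ ≤ ‖x‖ + R := (norm_sub_le x y).trans (by linarith)
  have := pow_le_pow_left₀ (norm_nonneg _) h1 2
  simp only [cost]; linarith

lemma exp_le_gker (hε : 0 < ε) (x : Euc d) {y : Euc d} {R : ℝ} (hy : ‖y‖ ≤ R) :
    ENNReal.ofReal (Real.exp (-(‖x‖ + R) ^ 2 / ε)) ≤ gker ε x y := by
  refine ENNReal.ofReal_le_ofReal (Real.exp_le_exp.2 ?_)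
  exact div_le_div_of_nonneg_right (neg_cost_le_of_norm_le x hy) hε.le

/-- A function that is not almost everywhere zero has mass in some ball, so that its image under
the kernel operator decays no faster than a Gaussian centred near the origin. -/
lemma exists_exp_le_gop (hε : 0 < ε) {μ : Measure (Euc d)} {φ : Euc d → ℝ≥0∞}
    (hφ : Measurable φ) (h0 : ¬ φ =ᵐ[μ] 0) :
    ∃ R c : ℝ, 0 < c ∧
      ∀ x, ENNReal.ofReal (c * Real.exp (-(‖x‖ + R) ^ 2 / ε)) ≤ gop ε μ φ x := by
  obtain ⟨n, hn⟩ : ∃ n : ℕ, ∫⁻ y in Metric.closedBall 0 n, φ y ∂μ ≠ 0 := by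
    by_contra! h
    refine h0 ?_
    have h' : ∀ n : ℕ, φ =ᵐ[μ.restrict (Metric.closedBall 0 n)] 0 := fun n =>
      (lintegral_eq_zero_iff hφ).1 (h n)
    have := ae_restrict_iUnion_iff (μ := μ) (fun n : ℕ => Metric.closedBall (0 : Euc d) n)
      (fun x => φ x = 0)
    rw [Metric.iUnion_closedBall_nat, Measure.restrict_univ] at this
    exact this.2 h'
  set I := ∫⁻ y in Metric.closedBall 0 n, φ y ∂μ
  have hc : min I 1 ≠ ∞ := by simp
  refine ⟨n, (min I 1).toReal, ENNReal.toReal_pos (by simpa using hn) hc, fun x => ?_⟩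
  rw [ENNReal.ofReal_mul ENNReal.toReal_nonneg, ENNReal.ofReal_toReal hc]
  calc min I 1 * ENNReal.ofReal (Real.exp (-(‖x‖ + n) ^ 2 / ε))
      ≤ I * ENNReal.ofReal (Real.exp (-(‖x‖ + n) ^ 2 / ε)) := by
        gcongr; exact min_le_left _ _
    _ = ∫⁻ y in Metric.closedBall 0 n, ENNReal.ofReal (Real.exp (-(‖x‖ + n) ^ 2 / ε)) * φ y ∂μ := by
        rw [lintegral_const_mul _ hφ, mul_comm]
    _ ≤ ∫⁻ y in Metric.closedBall 0 n, gker ε x y * φ y ∂μ := by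
        refine setLIntegral_mono' Metric.isClosed_closedBall.measurableSet fun y hy => ?_
        gcongr
        exact exp_le_gker hε x (by simpa using hy)
    _ ≤ gop ε μ φ x := setLIntegral_le_lintegral _ _

/-- Against a sub-Gaussian measure, the kernel operator maps a function of growth
`exp ((‖y‖ + R)² / ε)` to one with at most the exponential of a quadratic growth: the Gaussian
factor cancels `exp (‖y‖² / ε)` and leaves an exponential of a linear function of `‖y‖`. -/
lemma exists_gop_le_exp (hε : 0 < ε) {μ : Prob d} (hμ : μ ∈ subGaussian d) {R C : ℝ}
    {φ : Euc d → ℝ≥0∞}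
    (hφ : ∀ y, φ y ≤ ENNReal.ofReal (C * Real.exp ((‖y‖ + R) ^ 2 / ε))) :
    ∃ A : ℝ, 0 ≤ A ∧ ∀ x, gop ε (μ : Measure (Euc d)) φ x ≤
      ENNReal.ofReal (Real.exp (A * (1 + ‖x‖ ^ 2))) := by
  obtain ⟨q, hq, hint⟩ := hμ
  set M := ∫ y, Real.exp (q * ‖y‖ ^ 2) ∂(μ : Measure (Euc d))
  have hM : 0 ≤ M := integral_nonneg fun y => (Real.exp_pos _).le
  set C' := max C 1
  have hC' : 1 ≤ C' := le_max_right _ _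
  -- Young's inequality absorbs the linear term of the exponent into `q * ‖y‖ ^ 2`
  have key : ∀ x y : Euc d, -cost x y / ε + (‖y‖ + R) ^ 2 / ε ≤
      (R ^ 2 / ε + (‖x‖ + R) ^ 2 / (q * ε ^ 2)) + q * ‖y‖ ^ 2 := by
    intro x y
    have h1 : (‖x‖ - ‖y‖) ^ 2 ≤ cost x y := by
      simp only [cost]
      rw [← sq_abs]
      exact pow_le_pow_left₀ (abs_nonneg _) (abs_norm_sub_norm_le x y) 2
    have h2 : -cost x y + (‖y‖ + R) ^ 2 ≤ R ^ 2 + 2 * (‖x‖ + R) * ‖y‖ := by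
      nlinarith [sq_nonneg ‖x‖]
    have h3 : 2 * (‖x‖ + R) * ‖y‖ / ε ≤ (‖x‖ + R) ^ 2 / (q * ε ^ 2) + q * ‖y‖ ^ 2 := by
      have : (‖x‖ + R) ^ 2 / (q * ε ^ 2) + q * ‖y‖ ^ 2 - 2 * (‖x‖ + R) * ‖y‖ / ε =
          q * (‖y‖ - (‖x‖ + R) / (q * ε)) ^ 2 := by
        field_simp; ring
      nlinarith [mul_nonneg hq.le (sq_nonneg (‖y‖ - (‖x‖ + R) / (q * ε)))]
    calc -cost x y / ε + (‖y‖ + R) ^ 2 / ε = (-cost x y + (‖y‖ + R) ^ 2) / ε := by ring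
      _ ≤ (R ^ 2 + 2 * (‖x‖ + R) * ‖y‖) / ε := by gcongr
      _ ≤ _ := by rw [add_div]; linarith
  set A := (C' * (M + 1)) + R ^ 2 / ε + 2 * (1 + R ^ 2) / (q * ε ^ 2)
  have hA : 0 ≤ A := by positivity
  refine ⟨A, hA, fun x => ?_⟩
  set L := R ^ 2 / ε + (‖x‖ + R) ^ 2 / (q * ε ^ 2)
  calc gop ε (μ : Measure (Euc d)) φ x
      ≤ ∫⁻ y, ENNReal.ofReal (C' * Real.exp L * Real.exp (q * ‖y‖ ^ 2)) ∂(μ : Measure (Euc d)) := by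
        refine lintegral_mono fun y => ?_
        refine (mul_le_mul_right (hφ y) _).trans ?_
        rw [gker, ← ENNReal.ofReal_mul (Real.exp_pos _).le]
        refine ENNReal.ofReal_le_ofReal ?_
        calc Real.exp (-cost x y / ε) * (C * Real.exp ((‖y‖ + R) ^ 2 / ε))
            = C * Real.exp (-cost x y / ε + (‖y‖ + R) ^ 2 / ε) := by rw [Real.exp_add]; ring
          _ ≤ C' * Real.exp (L + q * ‖y‖ ^ 2) := by
              exact mul_le_mul (le_max_left _ _) (Real.exp_le_exp.2 (key x y))
                (Real.exp_pos _).le (by positivity)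
          _ = _ := by rw [Real.exp_add]; ring
    _ = ENNReal.ofReal (C' * Real.exp L * M) := by
        rw [← ofReal_integral_eq_lintegral_ofReal (hint.const_mul _)
          (Eventually.of_forall fun y => by positivity), integral_const_mul]
    _ ≤ _ := by
        refine ENNReal.ofReal_le_ofReal ?_
        have h1 : C' * M ≤ Real.exp (C' * (M + 1)) := by
          have := Real.add_one_le_exp (C' * (M + 1)); nlinarith
        have h2 : (‖x‖ + R) ^ 2 ≤ 2 * (1 + R ^ 2) * (1 + ‖x‖ ^ 2) := by
          nlinarith [sq_nonneg (‖x‖ - R), sq_nonneg (‖x‖ * R)]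
        calc C' * Real.exp L * M = C' * M * Real.exp L := by ring
          _ ≤ Real.exp (C' * (M + 1)) * Real.exp L := by gcongr
          _ = Real.exp (C' * (M + 1) + L) := (Real.exp_add _ _).symm
          _ ≤ _ := by
            refine Real.exp_le_exp.2 ?_
            have h3 : (‖x‖ + R) ^ 2 / (q * ε ^ 2) ≤
                2 * (1 + R ^ 2) / (q * ε ^ 2) * (1 + ‖x‖ ^ 2) := by
              rw [div_mul_eq_mul_div]; gcongr
            have h4 : 0 ≤ ((C' * (M + 1)) + R ^ 2 / ε) * ‖x‖ ^ 2 := by positivity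
            simp only [A, L]; nlinarith

/-- The kernel operators of `α` and `β` are adjoint to each other, by Tonelli's theorem. -/
lemma lintegral_mul_gop_comm (μ ν : Measure (Euc d)) [SFinite μ] [SFinite ν] {φ ψ : Euc d → ℝ≥0∞}
    (hφ : Measurable φ) (hψ : Measurable ψ) :
    ∫⁻ x, φ x * gop ε ν ψ x ∂μ = ∫⁻ y, ψ y * gop ε μ φ y ∂ν := by
  have h1 : ∀ x, φ x * gop ε ν ψ x = ∫⁻ y, φ x * (gker ε x y * ψ y) ∂ν := fun x => by
    rw [gop, lintegral_const_mul _ (by fun_prop)]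
  have h2 : ∀ y, ψ y * gop ε μ φ y = ∫⁻ x, φ x * (gker ε x y * ψ y) ∂μ := fun y => by
    rw [gop, ← lintegral_const_mul _ (by fun_prop)]
    refine lintegral_congr fun x => ?_
    rw [gker_comm]; ring
  simp_rw [h1, h2]
  exact lintegral_lintegral_swap (by fun_prop)

/-! ### Existence of Schrödinger potentials by a monotone iteration -/

/-- The map `h ↦ 𝒦((𝒦ᵀ(h⁻¹ α))⁻¹ β)`, whose fixed points are the reciprocals of the first
scaling factor `exp (f / ε)`. It is isotone. -/
def fortet (ε : ℝ) (α β : Measure (Euc d)) (h : Euc d → ℝ≥0∞) : Euc d → ℝ≥0∞ :=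
  gop ε β (gop ε α h⁻¹)⁻¹

lemma fortet_mono (α β : Measure (Euc d)) : Monotone (fortet ε α β) := fun _ _ hh x =>
  gop_mono (fun y => ENNReal.inv_le_inv.2 (gop_mono (fun z => ENNReal.inv_le_inv.2 (hh z)) y)) x

lemma measurable_fortet (α β : Measure (Euc d)) [SFinite α] [SFinite β] {h : Euc d → ℝ≥0∞}
    (hh : Measurable h) : Measurable (fortet ε α β h) :=
  measurable_gop _ (measurable_gop _ hh.inv).inv

/-- The lower barrier of the iteration: a lower bound of `exp (-C(x, z) / ε)` over `‖z‖ ≤ R`. -/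
def barrier (ε R : ℝ) (x : Euc d) : ℝ≥0∞ := ENNReal.ofReal (Real.exp (-(‖x‖ + R) ^ 2 / ε))

@[fun_prop]
lemma measurable_barrier (R : ℝ) : Measurable (barrier ε R : Euc d → ℝ≥0∞) := by
  unfold barrier; fun_prop

lemma barrier_inv (R : ℝ) (x : Euc d) :
    (barrier ε R x)⁻¹ = ENNReal.ofReal (1 * Real.exp ((‖x‖ + R) ^ 2 / ε)) := by
  rw [barrier, ← ENNReal.ofReal_inv_of_pos (Real.exp_pos _), ← Real.exp_neg, one_mul, neg_div,
    neg_neg]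

/-- Above the barrier, all scaling factors are finite and positive at every point, and the mass
identity `∫ Ω(h) / h dα = 1` holds. -/
lemma fortet_properties (hε : 0 < ε) {α β : Prob d} (hα : α ∈ subGaussian d)
    (hβ : β ∈ subGaussian d) {R : ℝ} {h : Euc d → ℝ≥0∞} (hh : Measurable h)
    (hb : barrier ε R ≤ h) (hfin : ¬ h⁻¹ =ᵐ[(α : Measure (Euc d))] 0) :
    (∀ y, gop ε (α : Measure (Euc d)) h⁻¹ y ≠ 0 ∧ gop ε (α : Measure (Euc d)) h⁻¹ y ≠ ∞) ∧
    (∀ x, fortet ε (α : Measure (Euc d)) β h x ≠ 0 ∧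
      fortet ε (α : Measure (Euc d)) β h x ≠ ∞) ∧
    ∫⁻ x, h⁻¹ x * fortet ε (α : Measure (Euc d)) β h x ∂(α : Measure (Euc d)) = 1 := by
  obtain ⟨S, c, hc, hlow⟩ := exists_exp_le_gop hε hh.inv hfin
  have hT0 : ∀ y, gop ε (α : Measure (Euc d)) h⁻¹ y ≠ 0 := fun y h0 => by
    have := hlow y
    rw [h0, nonpos_iff_eq_zero, ENNReal.ofReal_eq_zero] at this
    exact absurd this (not_le.2 (by positivity))
  have hTtop : ∀ y, gop ε (α : Measure (Euc d)) h⁻¹ y ≠ ∞ := by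
    obtain ⟨A, -, hA⟩ := exists_gop_le_exp (C := 1) hε hα (φ := h⁻¹) fun y => by
      rw [← barrier_inv]; exact ENNReal.inv_le_inv.2 (hb y)
    exact fun y => ((hA y).trans_lt ENNReal.ofReal_lt_top).ne
  have hmeas := measurable_gop (ε := ε) (α : Measure (Euc d)) hh.inv
  refine ⟨fun y => ⟨hT0 y, hTtop y⟩, fun x => ⟨fun h0 => ?_, ?_⟩, ?_⟩
  · have hne : ¬ (gop ε (α : Measure (Euc d)) h⁻¹)⁻¹ =ᵐ[(β : Measure (Euc d))] 0 := fun h0 => by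
      obtain ⟨y, hy⟩ := h0.exists
      exact hTtop y (by simpa using hy)
    obtain ⟨S', c', hc', hlow'⟩ := exists_exp_le_gop hε hmeas.inv hne
    have := hlow' x
    rw [show gop ε (β : Measure (Euc d)) _ x = 0 from h0, nonpos_iff_eq_zero,
      ENNReal.ofReal_eq_zero] at this
    exact absurd this (not_le.2 (by positivity))
  · obtain ⟨A, -, hA⟩ := exists_gop_le_exp (C := c⁻¹) hε hβ
      (φ := (gop ε (α : Measure (Euc d)) h⁻¹)⁻¹) fun y => by
        refine (ENNReal.inv_le_inv.2 (hlow y)).trans ?_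
        rw [← ENNReal.ofReal_inv_of_pos (by positivity), mul_inv, ← Real.exp_neg, neg_div, neg_neg]
    exact ((hA x).trans_lt ENNReal.ofReal_lt_top).ne
  · unfold fortet
    rw [lintegral_mul_gop_comm _ _ hh.inv hmeas.inv]
    simp_rw [Pi.inv_apply, ENNReal.inv_mul_cancel (hT0 _) (hTtop _)]
    simp

/-- A super- or sub-solution above the barrier is a solution, by the mass identity. -/
lemma fortet_ae_eq (hε : 0 < ε) {α β : Prob d} (hα : α ∈ subGaussian d)
    (hβ : β ∈ subGaussian d) {R : ℝ} {h : Euc d → ℝ≥0∞} (hh : Measurable h)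
    (hb : barrier ε R ≤ h) (htop : ∀ x, h x ≠ ∞)
    (hcmp : h ≤ fortet ε (α : Measure (Euc d)) β h ∨ fortet ε (α : Measure (Euc d)) β h ≤ h) :
    fortet ε (α : Measure (Euc d)) β h =ᵐ[(α : Measure (Euc d))] h := by
  have hfin : ¬ h⁻¹ =ᵐ[(α : Measure (Euc d))] 0 := fun h0 => by
    obtain ⟨y, hy⟩ := h0.exists
    exact htop y (by simpa using hy)
  obtain ⟨-, -, h1⟩ := fortet_properties hε hα hβ hh hb hfin
  have hpos : ∀ x, h x ≠ 0 := fun x h0 => by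
    have := hb x
    rw [h0, barrier, nonpos_iff_eq_zero, ENNReal.ofReal_eq_zero] at this
    exact absurd this (not_le.2 (Real.exp_pos _))
  have hm := measurable_fortet (ε := ε) (α : Measure (Euc d)) (β : Measure (Euc d)) hh
  have hone : (fun x => h⁻¹ x * fortet ε (α : Measure (Euc d)) β h x)
      =ᵐ[(α : Measure (Euc d))] fun _ => 1 := by
    rcases hcmp with hc | hc
    · refine (ae_eq_of_ae_le_of_lintegral_le (Eventually.of_forall fun x => ?_) (by simp)
        (hh.inv.mul hm).aemeasurable (by simp [-Pi.inv_apply, h1])).symm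
      calc (1 : ℝ≥0∞) = h⁻¹ x * h x := (ENNReal.inv_mul_cancel (hpos x) (htop x)).symm
        _ ≤ _ := mul_le_mul_right (hc x) _
    · refine ae_eq_of_ae_le_of_lintegral_le (Eventually.of_forall fun x => ?_) (by rw [h1]; simp)
        (by fun_prop) (by rw [h1]; simp)
      calc h⁻¹ x * fortet ε (α : Measure (Euc d)) β h x ≤ h⁻¹ x * h x := mul_le_mul_right (hc x) _
        _ = 1 := ENNReal.inv_mul_cancel (hpos x) (htop x)
  filter_upwards [hone] with x hx
  rw [← mul_one (h x), ← hx, Pi.inv_apply, ← mul_assoc, ENNReal.mul_inv_cancel (hpos x) (htop x),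
    one_mul]

/-- The increasing iteration `h ↦ max (Ω(h), barrier)` from the barrier. -/
def fortetSeq (ε R : ℝ) (α β : Measure (Euc d)) : ℕ → Euc d → ℝ≥0∞
  | 0 => barrier ε R
  | n + 1 => fortet ε α β (fortetSeq ε R α β n) ⊔ barrier ε R

lemma fortetSeq_mono (R : ℝ) (α β : Measure (Euc d)) : Monotone (fortetSeq ε R α β) := by
  refine monotone_nat_of_le_succ fun n => ?_
  induction n with
  | zero => exact le_sup_right
  | succ n ih => exact sup_le_sup_right (fortet_mono α β ih) _

lemma barrier_le_fortetSeq (R : ℝ) (α β : Measure (Euc d)) (n : ℕ) :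
    barrier ε R ≤ fortetSeq ε R α β n := fortetSeq_mono R α β (Nat.zero_le n)

lemma measurable_fortetSeq (R : ℝ) (α β : Measure (Euc d)) [SFinite α] [SFinite β] (n : ℕ) :
    Measurable (fortetSeq ε R α β n) := by
  induction n with
  | zero => exact measurable_barrier R
  | succ n ih => exact (measurable_fortet α β ih).sup (measurable_barrier R)

lemma fortetSeq_ne_top (hε : 0 < ε) {α β : Prob d} (hα : α ∈ subGaussian d)
    (hβ : β ∈ subGaussian d) {R : ℝ} (n : ℕ) (x : Euc d) :
    fortetSeq ε R (α : Measure (Euc d)) β n x ≠ ∞ := by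
  induction n generalizing x with
  | zero => exact ENNReal.ofReal_ne_top
  | succ n ih =>
    have hfin : ¬ (fortetSeq ε R (α : Measure (Euc d)) β n)⁻¹ =ᵐ[(α : Measure (Euc d))] 0 := by
      intro h0
      obtain ⟨y, hy⟩ := h0.exists
      exact ih y (by simpa using hy)
    have := ((fortet_properties hε hα hβ (measurable_fortetSeq R _ _ n)
      (barrier_le_fortetSeq R _ _ n) hfin).2.1 x).2
    exact (max_lt this.lt_top ENNReal.ofReal_lt_top).ne

/-- Existence of a solution above the barrier. Either some iterate charges the ball `‖y‖ ≤ R`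
enough for `Ω` to stay above the barrier, and then the next step is the one of the mass-preserving
map `Ω`, so that the iteration is stationary; or the iterates cannot blow up, and their supremum
is a supersolution. -/
lemma exists_fortet_fixedPoint (hε : 0 < ε) {α β : Prob d} (hα : α ∈ subGaussian d)
    (hβ : β ∈ subGaussian d) :
    ∃ (R : ℝ) (h : Euc d → ℝ≥0∞), Measurable h ∧ barrier ε R ≤ h ∧ (∀ x, h x ≠ ∞) ∧
      fortet ε (α : Measure (Euc d)) β h =ᵐ[(α : Measure (Euc d))] h := by
  obtain ⟨R, hR⟩ : ∃ R : ℕ, (β : Measure (Euc d)) (Metric.closedBall 0 R) ≠ 0 := by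
    by_contra! hcon
    have := measure_iUnion_null hcon
    rw [Metric.iUnion_closedBall_nat] at this
    simp at this
  set B := Metric.closedBall (0 : Euc d) R
  have hBm : MeasurableSet B := Metric.isClosed_closedBall.measurableSet
  set s := fortetSeq ε (R : ℝ) (α : Measure (Euc d)) β
  have hsm : ∀ n, Measurable (s n) := measurable_fortetSeq _ _ _
  have hsb : ∀ n, barrier ε R ≤ s n := barrier_le_fortetSeq _ _ _
  have hst : ∀ n x, s n x ≠ ∞ := fortetSeq_ne_top hε hα hβ
  have hmono : Monotone s := fortetSeq_mono _ _ _
  set G := fun n => gop ε (α : Measure (Euc d)) (s n)⁻¹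
  have hGm : ∀ n, Measurable (G n) := fun n => measurable_gop _ (hsm n).inv
  have hGanti : Antitone G := fun m n hmn y =>
    gop_mono (fun z => ENNReal.inv_le_inv.2 (hmono hmn z)) y
  by_cases hcase : ∃ n, 1 ≤ ∫⁻ y in B, (G n)⁻¹ y ∂(β : Measure (Euc d))
  · obtain ⟨n, hn⟩ := hcase
    refine ⟨R, s n, hsm n, hsb n, hst n,
      fortet_ae_eq hε hα hβ (hsm n) (hsb n) (hst n) (Or.inl ?_)⟩
    -- the mass of the ball keeps `Ω (s n)` above the barrier
    have hge : barrier ε R ≤ fortet ε (α : Measure (Euc d)) β (s n) := fun x =>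
      calc barrier ε R x ≤ barrier ε R x * ∫⁻ y in B, (G n)⁻¹ y ∂(β : Measure (Euc d)) :=
            le_mul_of_one_le_right' hn
        _ = ∫⁻ y in B, barrier ε R x * (G n)⁻¹ y ∂(β : Measure (Euc d)) :=
            (lintegral_const_mul _ (hGm n).inv).symm
        _ ≤ ∫⁻ y in B, gker ε x y * (G n)⁻¹ y ∂(β : Measure (Euc d)) := by
            refine setLIntegral_mono' hBm fun y hy => ?_
            gcongr
            exact exp_le_gker hε x (by simpa [B] using hy)
        _ ≤ _ := setLIntegral_le_lintegral _ _
    have : s (n + 1) = fortet ε (α : Measure (Euc d)) β (s n) := sup_eq_left.2 hge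
    rw [← this]
    exact hmono n.le_succ
  · push Not at hcase
    set h : Euc d → ℝ≥0∞ := fun x => ⨆ n, s n x
    have hhm : Measurable h := Measurable.iSup hsm
    have hinv : ∀ x, h⁻¹ x = ⨅ n, (s n)⁻¹ x := fun x => by
      simp only [h, Pi.inv_apply, ENNReal.inv_iSup]
    have hG0 : ∀ y, G 0 y ≠ ∞ := by
      have hfin : ¬ (s 0)⁻¹ =ᵐ[(α : Measure (Euc d))] 0 := fun h0 => by
        obtain ⟨y, hy⟩ := h0.exists
        exact hst 0 y (by simpa using hy)
      exact fun y => ((fortet_properties hε hα hβ (hsm 0) (hsb 0) hfin).1 y).2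
    have hGlim : ∀ y, gop ε (α : Measure (Euc d)) h⁻¹ y = ⨅ n, G n y := fun y => by
      simp only [G, gop]
      rw [← lintegral_iInf (f := fun n z => gker ε y z * (s n)⁻¹ z)
        (fun n => by have := (hsm n).inv; fun_prop)
        (fun m n hmn z => mul_le_mul_right (ENNReal.inv_le_inv.2 (hmono hmn z)) _) (hG0 y)]
      refine lintegral_congr fun z => ?_
      rw [hinv, ENNReal.mul_iInf_of_ne (gker_ne_zero _ _) (gker_ne_top _ _)]
    have hGinv : ∀ y, (gop ε (α : Measure (Euc d)) h⁻¹)⁻¹ y = ⨆ n, (G n)⁻¹ y := fun y => by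
      rw [Pi.inv_apply, hGlim, ENNReal.inv_iInf]; rfl
    have hΩ : ∀ x, fortet ε (α : Measure (Euc d)) β h x =
        ⨆ n, fortet ε (α : Measure (Euc d)) β (s n) x := fun x => by
      simp only [fortet, gop]
      rw [← lintegral_iSup (f := fun n z => gker ε x z * (G n)⁻¹ z)
        (fun n => by have := (hGm n).inv; fun_prop)
        (fun m n hmn z => mul_le_mul_right (ENNReal.inv_le_inv.2 (hGanti hmn z)) _)]
      refine lintegral_congr fun z => ?_
      rw [hGinv z, ENNReal.mul_iSup]
    have hle : fortet ε (α : Measure (Euc d)) β h ≤ h := fun x => by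
      rw [hΩ]
      exact iSup_le fun n =>
        (le_sup_left : _ ≤ s (n + 1) x).trans (le_iSup (fun n => s n x) (n + 1))
    have hbar : barrier ε R ≤ h := fun x => (hsb 0 x).trans (le_iSup (fun n => s n x) 0)
    -- `h = ∞` almost everywhere would make the mass that `β / 𝒦ᵀ(h⁻¹ α)` gives to the ball infinite
    have hfin : ¬ h⁻¹ =ᵐ[(α : Measure (Euc d))] 0 := by
      intro h0
      have hzero : ∀ y, gop ε (α : Measure (Euc d)) h⁻¹ y = 0 := fun y => by
        rw [gop]
        refine (lintegral_congr_ae ?_).trans lintegral_zero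
        filter_upwards [h0] with z hz
        rw [hz]; simp
      have hmass : ∫⁻ y in B, (gop ε (α : Measure (Euc d)) h⁻¹)⁻¹ y ∂(β : Measure (Euc d)) ≤ 1 := by
        simp_rw [hGinv]
        rw [lintegral_iSup (fun n => (hGm n).inv)
          (fun m n hmn z => ENNReal.inv_le_inv.2 (hGanti hmn z))]
        exact iSup_le fun n => (hcase n).le
      simp_rw [Pi.inv_apply, hzero, ENNReal.inv_zero] at hmass
      rw [lintegral_const, Measure.restrict_apply_univ, ENNReal.top_mul hR] at hmass
      simp at hmass
    obtain ⟨-, h2, -⟩ := fortet_properties hε hα hβ hhm hbar hfin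
    have htop : ∀ x, h x ≠ ∞ := fun x => by
      have : h x ≤ fortet ε (α : Measure (Euc d)) β h x ⊔ barrier ε R x := by
        refine iSup_le fun n => ?_
        refine (hmono n.le_succ x).trans (sup_le_sup_right ?_ _)
        rw [hΩ]
        exact le_iSup (fun n => fortet ε (α : Measure (Euc d)) β (s n) x) n
      exact (this.trans_lt (max_lt (h2 x).2.lt_top ENNReal.ofReal_lt_top)).ne
    exact ⟨R, h, hhm, hbar, htop, fortet_ae_eq hε hα hβ hhm hbar htop (Or.inr hle)⟩

/-! ### Regularity and growth of the potentials -/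

/-- At most quadratic growth, which makes a measurable function integrable against every
sub-Gaussian measure. -/
def QuadGrowth (f : Euc d → ℝ) : Prop := ∃ A : ℝ, 0 ≤ A ∧ ∀ x, |f x| ≤ A * (1 + ‖x‖ ^ 2)

/-- `f = -ε log 𝒦(exp (φ / ε) μ)` at every point: the soft `C`-transform. -/
def IsSoftTransform (ε : ℝ) (μ : Measure (Euc d)) (φ f : Euc d → ℝ) : Prop :=
  ∀ x, gop ε μ (fun y => ENNReal.ofReal (Real.exp (φ y / ε))) x =
    ENNReal.ofReal (Real.exp (-f x / ε))

/-- Solutions of the Sinkhorn equations together with the regularity that the equations force. -/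
structure Potentials (ε : ℝ) (α β : Prob d) (f g : Euc d → ℝ) : Prop where
  meas_left : Measurable f
  meas_right : Measurable g
  growth_left : QuadGrowth f
  growth_right : QuadGrowth g
  left : IsSoftTransform ε (β : Measure (Euc d)) g f
  right : IsSoftTransform ε (α : Measure (Euc d)) f g

lemma QuadGrowth.integrable {f : Euc d → ℝ} (hf : QuadGrowth f) (hm : Measurable f) {μ : Prob d}
    (hμ : μ ∈ subGaussian d) : Integrable f (μ : Measure (Euc d)) := by
  obtain ⟨A, hA, hfA⟩ := hf
  obtain ⟨q, hq, hint⟩ := hμ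
  refine (hint.const_mul (A * (1 + q⁻¹))).mono' hm.aestronglyMeasurable
    (Eventually.of_forall fun x => ?_)
  refine (hfA x).trans ?_
  rw [mul_assoc]
  refine mul_le_mul_of_nonneg_left ?_ hA
  have h1 := Real.add_one_le_exp (q * ‖x‖ ^ 2)
  have h2 : ‖x‖ ^ 2 = q⁻¹ * (q * ‖x‖ ^ 2) := by field_simp
  have h3 : 1 ≤ Real.exp (q * ‖x‖ ^ 2) := Real.one_le_exp (by positivity)
  have h4 : q⁻¹ * (q * ‖x‖ ^ 2) ≤ q⁻¹ * Real.exp (q * ‖x‖ ^ 2) :=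
    mul_le_mul_of_nonneg_left (by linarith) (by positivity)
  linarith

lemma QuadGrowth.exists_bound {f : Euc d → ℝ} (hf : QuadGrowth f) (R : ℝ) :
    ∃ M : ℝ, ∀ x, ‖x‖ ≤ R → |f x| ≤ M := by
  obtain ⟨A, hA, hfA⟩ := hf
  refine ⟨A * (1 + R ^ 2), fun x hx => (hfA x).trans ?_⟩
  gcongr

/-- An integral that is not zero is one of an integrable function, which makes the potential in the
integrand almost everywhere measurable and its transform measurable. -/
lemma softTransform_of_integral (hε : 0 < ε) {μ : Prob d} {φ f : Euc d → ℝ}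
    (h : ∀ x, Real.exp (f x / ε) *
      ∫ y, Real.exp (-cost x y / ε) * Real.exp (φ y / ε) ∂(μ : Measure (Euc d)) = 1) :
    Measurable f ∧ IsSoftTransform ε (μ : Measure (Euc d)) φ f := by
  have hval : ∀ x, ∫ y, Real.exp (-cost x y / ε) * Real.exp (φ y / ε) ∂(μ : Measure (Euc d)) =
      Real.exp (-f x / ε) := fun x => by
    rw [neg_div, Real.exp_neg]
    exact eq_inv_of_mul_eq_one_right (h x)
  have hint : ∀ x, Integrable (fun y => Real.exp (-cost x y / ε) * Real.exp (φ y / ε))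
      (μ : Measure (Euc d)) := fun x => by
    by_contra hn
    have := h x
    rw [integral_undef hn] at this
    simp at this
  have hsoft : IsSoftTransform ε (μ : Measure (Euc d)) φ f := fun x => by
    rw [← hval, ofReal_integral_eq_lintegral_ofReal (hint x)
      (Eventually.of_forall fun y => by positivity)]
    refine lintegral_congr fun y => ?_
    rw [gker, ENNReal.ofReal_mul (Real.exp_pos _).le]
  have hae : AEMeasurable (fun y => ENNReal.ofReal (Real.exp (φ y / ε))) (μ : Measure (Euc d)) := by
    have h1 : AEMeasurable (fun y => ENNReal.ofReal (Real.exp (cost 0 y / ε)) *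
        ENNReal.ofReal (Real.exp (-cost 0 y / ε) * Real.exp (φ y / ε))) (μ : Measure (Euc d)) := by
      refine AEMeasurable.mul ?_ (hint 0).aestronglyMeasurable.aemeasurable.ennreal_ofReal
      unfold cost
      fun_prop
    refine h1.congr (Eventually.of_forall fun y => ?_)
    dsimp only
    rw [← ENNReal.ofReal_mul (Real.exp_pos _).le, ← mul_assoc, ← Real.exp_add, neg_div,
      add_neg_cancel, Real.exp_zero, one_mul]
  have hg : ∀ x,
      f x = -ε * Real.log (gop ε (μ : Measure (Euc d)) (hae.mk _) x).toReal := fun x => by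
    have : gop ε (μ : Measure (Euc d)) (hae.mk _) x = ENNReal.ofReal (Real.exp (-f x / ε)) := by
      rw [← hsoft x]
      refine lintegral_congr_ae ?_
      filter_upwards [hae.ae_eq_mk] with y hy
      rw [hy]
    rw [this, ENNReal.toReal_ofReal (Real.exp_pos _).le, Real.log_exp]
    field_simp
  refine ⟨?_, hsoft⟩
  have hm := measurable_gop (ε := ε) (μ : Measure (Euc d)) hae.measurable_mk
  rw [show f = _ from funext hg]
  fun_prop

lemma IsSoftTransform.integral_eq {μ : Prob d} {φ f : Euc d → ℝ} (hφ : Measurable φ)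
    (h : IsSoftTransform ε (μ : Measure (Euc d)) φ f) (x : Euc d) :
    Integrable (fun y => Real.exp (-cost x y / ε) * Real.exp (φ y / ε)) (μ : Measure (Euc d)) ∧
    ∫ y, Real.exp (-cost x y / ε) * Real.exp (φ y / ε) ∂(μ : Measure (Euc d)) =
      Real.exp (-f x / ε) := by
  have hmeas : Measurable fun y => Real.exp (-cost x y / ε) * Real.exp (φ y / ε) := by
    unfold cost; fun_prop
  have hl : ∫⁻ y, ENNReal.ofReal (Real.exp (-cost x y / ε) * Real.exp (φ y / ε))
      ∂(μ : Measure (Euc d)) = ENNReal.ofReal (Real.exp (-f x / ε)) := by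
    rw [← h x]
    refine lintegral_congr fun y => ?_
    rw [gker, ENNReal.ofReal_mul (Real.exp_pos _).le]
  have hpos : 0 ≤ᵐ[(μ : Measure (Euc d))]
      fun y => Real.exp (-cost x y / ε) * Real.exp (φ y / ε) :=
    Eventually.of_forall fun y => by positivity
  refine ⟨⟨hmeas.aestronglyMeasurable, ?_⟩, ?_⟩
  · rw [hasFiniteIntegral_iff_ofReal hpos, hl]
    exact ENNReal.ofReal_lt_top
  · rw [integral_eq_lintegral_of_nonneg_ae hpos hmeas.aestronglyMeasurable, hl,
      ENNReal.toReal_ofReal (Real.exp_pos _).le]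

lemma IsSoftTransform.le (hε : 0 < ε) {μ : Prob d} {φ f : Euc d → ℝ} (hφ : Measurable φ)
    (h : IsSoftTransform ε (μ : Measure (Euc d)) φ f) :
    ∃ R A : ℝ, ∀ x, f x ≤ A + (‖x‖ + R) ^ 2 := by
  have hne : ¬ (fun y => ENNReal.ofReal (Real.exp (φ y / ε))) =ᵐ[(μ : Measure (Euc d))] 0 := by
    intro h0
    obtain ⟨y, hy⟩ := h0.exists
    exact absurd (ENNReal.ofReal_eq_zero.1 hy) (not_le.2 (Real.exp_pos _))
  obtain ⟨R, c, hc, hb⟩ := exists_exp_le_gop hε (by fun_prop) hne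
  refine ⟨R, -ε * Real.log c, fun x => ?_⟩
  have h1 := hb x
  rw [h x, ENNReal.ofReal_le_ofReal_iff (Real.exp_pos _).le, ← Real.exp_log hc, ← Real.exp_add,
    Real.exp_le_exp] at h1
  have h2 := mul_le_mul_of_nonneg_left h1 hε.le
  have h3 : ε * (Real.log c + -(‖x‖ + R) ^ 2 / ε) = ε * Real.log c - (‖x‖ + R) ^ 2 := by
    field_simp; ring
  have h4 : ε * (-f x / ε) = -f x := by field_simp
  rw [h3, h4] at h2
  linarith

lemma IsSoftTransform.ge (hε : 0 < ε) {μ : Prob d} (hμ : μ ∈ subGaussian d) {φ f : Euc d → ℝ}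
    (h : IsSoftTransform ε (μ : Measure (Euc d)) φ f) {R A : ℝ}
    (hle : ∀ x, φ x ≤ A + (‖x‖ + R) ^ 2) :
    ∃ B : ℝ, 0 ≤ B ∧ ∀ x, -f x ≤ B * (1 + ‖x‖ ^ 2) := by
  obtain ⟨B, hB, hb⟩ := exists_gop_le_exp (C := Real.exp (A / ε)) (R := R) hε hμ
    (φ := fun y => ENNReal.ofReal (Real.exp (φ y / ε))) fun y => by
      refine ENNReal.ofReal_le_ofReal ?_
      rw [← Real.exp_add, ← add_div]
      exact Real.exp_le_exp.2 (div_le_div_of_nonneg_right (hle y) hε.le)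
  refine ⟨ε * B, by positivity, fun x => ?_⟩
  have h1 := hb x
  rw [h x, ENNReal.ofReal_le_ofReal_iff (Real.exp_pos _).le, Real.exp_le_exp, div_le_iff₀ hε] at h1
  linarith

lemma quadGrowth_of_bounds {f : Euc d → ℝ} {R A B : ℝ} (hB : 0 ≤ B)
    (hle : ∀ x, f x ≤ A + (‖x‖ + R) ^ 2) (hge : ∀ x, -f x ≤ B * (1 + ‖x‖ ^ 2)) :
    QuadGrowth f := by
  refine ⟨|A| + 2 * (1 + R ^ 2) + B, by positivity, fun x => abs_le.2 ⟨?_, ?_⟩⟩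
  · have h1 : 0 ≤ (|A| + 2 * (1 + R ^ 2)) * (1 + ‖x‖ ^ 2) := by positivity
    have := hge x
    linarith
  · have h1 : 0 ≤ |A| * ‖x‖ ^ 2 := by positivity
    have h2 : 0 ≤ B * (1 + ‖x‖ ^ 2) := by positivity
    have := hle x
    have := le_abs_self A
    nlinarith [sq_nonneg (‖x‖ - R), sq_nonneg (‖x‖ * R)]

lemma IsSoftTransform.potentials (hε : 0 < ε) {α β : Prob d} (hα : α ∈ subGaussian d)
    (hβ : β ∈ subGaussian d) {f g : Euc d → ℝ} (hf : Measurable f) (hg : Measurable g)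
    (h1 : IsSoftTransform ε (β : Measure (Euc d)) g f)
    (h2 : IsSoftTransform ε (α : Measure (Euc d)) f g) : Potentials ε α β f g := by
  obtain ⟨R, A, hle1⟩ := h1.le hε hg
  obtain ⟨R', A', hle2⟩ := h2.le hε hf
  obtain ⟨B, hB, hge1⟩ := h1.ge hε hβ hle2
  obtain ⟨B', hB', hge2⟩ := h2.ge hε hα hle1
  exact ⟨hf, hg, quadGrowth_of_bounds hB hle1 hge1, quadGrowth_of_bounds hB' hle2 hge2, h1, h2⟩

lemma SinkhornEqs.potentials (hε : 0 < ε) {α β : Prob d} (hα : α ∈ subGaussian d)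
    (hβ : β ∈ subGaussian d) {f g : Euc d → ℝ} (h : SinkhornEqs ε α β f g) :
    Potentials ε α β f g := by
  obtain ⟨hf, h1⟩ := softTransform_of_integral hε (μ := β) (φ := g) (f := f) h.1
  obtain ⟨hg, h2⟩ := softTransform_of_integral hε (μ := α) (φ := f) (f := g) fun y => by
    rw [← h.2 y]
    simp only [kernelOpT, cost_comm y]
  exact IsSoftTransform.potentials hε hα hβ hf hg h1 h2

lemma AutoSinkhornEq.sinkhornEqs {α : Prob d} {h : Euc d → ℝ} (hh : AutoSinkhornEq ε α h) :
    SinkhornEqs ε α α h h := by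
  refine ⟨hh, fun y => ?_⟩
  rw [← hh y]
  simp only [kernelOpT, kernelOp, cost_comm y]

lemma Potentials.sinkhornEqs {α β : Prob d} {f g : Euc d → ℝ} (h : Potentials ε α β f g) :
    SinkhornEqs ε α β f g := by
  constructor
  · intro x
    rw [kernelOp, (h.left.integral_eq h.meas_right x).2, ← Real.exp_add, ← add_div, add_neg_cancel,
      zero_div, Real.exp_zero]
  · intro y
    simp only [kernelOpT, fun x => cost_comm x y]
    rw [(h.right.integral_eq h.meas_left y).2, ← Real.exp_add, ← add_div, add_neg_cancel, zero_div,
      Real.exp_zero]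

lemma Potentials.symm {α β : Prob d} {f g : Euc d → ℝ} (h : Potentials ε α β f g) :
    Potentials ε β α g f :=
  ⟨h.meas_right, h.meas_left, h.growth_right, h.growth_left, h.right, h.left⟩

lemma exists_potentials (hε : 0 < ε) {α β : Prob d} (hα : α ∈ subGaussian d)
    (hβ : β ∈ subGaussian d) : ∃ f g : Euc d → ℝ, Potentials ε α β f g := by
  obtain ⟨R, h, hhm, hb, htop, hfix⟩ := exists_fortet_fixedPoint hε hα hβ
  have hfin : ¬ h⁻¹ =ᵐ[(α : Measure (Euc d))] 0 := fun h0 => by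
    obtain ⟨y, hy⟩ := h0.exists
    exact htop y (by simpa using hy)
  obtain ⟨hG, hΩ, -⟩ := fortet_properties hε hα hβ hhm hb hfin
  set G := gop ε (α : Measure (Euc d)) h⁻¹
  set H := fortet ε (α : Measure (Euc d)) β h
  have hGm : Measurable G := measurable_gop _ hhm.inv
  have hHm : Measurable H := measurable_fortet _ _ hhm
  have hexp : ∀ {t : ℝ≥0∞}, t ≠ 0 → t ≠ ∞ →
      ENNReal.ofReal (Real.exp (-ε * Real.log t.toReal / ε)) = t⁻¹ ∧
      ENNReal.ofReal (Real.exp (-(-ε * Real.log t.toReal) / ε)) = t := fun {t} h0 ht => by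
    have hp := ENNReal.toReal_pos h0 ht
    have e1 : -ε * Real.log t.toReal / ε = -Real.log t.toReal := by field_simp
    have e2 : -(-ε * Real.log t.toReal) / ε = Real.log t.toReal := by field_simp
    rw [e1, e2, Real.exp_neg, Real.exp_log hp, ENNReal.ofReal_inv_of_pos hp,
      ENNReal.ofReal_toReal ht]
    exact ⟨rfl, rfl⟩
  refine ⟨fun x => -ε * Real.log (H x).toReal, fun y => -ε * Real.log (G y).toReal,
    IsSoftTransform.potentials hε hα hβ (by fun_prop) (by fun_prop) (fun x => ?_) fun y => ?_⟩
  · simp_rw [(hexp (hG _).1 (hG _).2).1, (hexp (hΩ _).1 (hΩ _).2).2]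
    rfl
  · simp_rw [(hexp (hG _).1 (hG _).2).2, (hexp (hΩ _).1 (hΩ _).2).1]
    refine lintegral_congr_ae ?_
    filter_upwards [hfix] with x hx
    rw [show H x = h x from hx, Pi.inv_apply]

/-! ### Entropic duality -/

/-- The Gibbs density `exp ((f(x) + g(y) - C(x, y)) / ε)`. -/
def gibbs (ε : ℝ) (f g : Euc d → ℝ) (p : Euc d × Euc d) : ℝ :=
  Real.exp ((f p.1 + g p.2 - cost p.1 p.2) / ε)

lemma gibbs_pos (f g : Euc d → ℝ) (p : Euc d × Euc d) : 0 < gibbs ε f g p := Real.exp_pos _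

lemma gibbs_swap (f g : Euc d → ℝ) (x y : Euc d) : gibbs ε f g (x, y) = gibbs ε g f (y, x) := by
  simp only [gibbs, cost_comm x y, add_comm (f x)]

@[fun_prop]
lemma measurable_gibbs {f g : Euc d → ℝ} (hf : Measurable f) (hg : Measurable g) :
    Measurable (gibbs ε f g) := by
  unfold gibbs cost; fun_prop

lemma IsSoftTransform.lintegral_gibbs {μ : Measure (Euc d)} {φ f : Euc d → ℝ}
    (h : IsSoftTransform ε μ φ f) (hφ : Measurable φ) (x : Euc d) :
    ∫⁻ y, ENNReal.ofReal (gibbs ε f φ (x, y)) ∂μ = 1 := by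
  have h1 : ∀ y, ENNReal.ofReal (gibbs ε f φ (x, y)) = ENNReal.ofReal (Real.exp (f x / ε)) *
      (gker ε x y * ENNReal.ofReal (Real.exp (φ y / ε))) := fun y => by
    rw [gker, ← ENNReal.ofReal_mul (Real.exp_pos _).le, ← ENNReal.ofReal_mul (Real.exp_pos _).le,
      ← Real.exp_add, ← Real.exp_add, gibbs]
    ring_nf
  simp_rw [h1]
  rw [lintegral_const_mul _ (by fun_prop), show ∫⁻ y, gker ε x y * _ ∂μ = _ from h x,
    ← ENNReal.ofReal_mul (Real.exp_pos _).le, ← Real.exp_add, ← add_div, add_neg_cancel, zero_div,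
    Real.exp_zero, ENNReal.ofReal_one]

lemma Potentials.lintegral_gibbs_right {α β : Prob d} {f g : Euc d → ℝ}
    (h : Potentials ε α β f g) (x : Euc d) :
    ∫⁻ y, ENNReal.ofReal (gibbs ε f g (x, y)) ∂(β : Measure (Euc d)) = 1 :=
  h.left.lintegral_gibbs h.meas_right x

lemma Potentials.lintegral_gibbs_left {α β : Prob d} {f g : Euc d → ℝ}
    (h : Potentials ε α β f g) (y : Euc d) :
    ∫⁻ x, ENNReal.ofReal (gibbs ε f g (x, y)) ∂(α : Measure (Euc d)) = 1 := by
  simp_rw [gibbs_swap f g]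
  exact h.symm.lintegral_gibbs_right y

/-- The Gibbs density of the potentials of `(α, β)` has mass one against `α ⊗ β'` for every
probability measure `β'`, because the second Sinkhorn equation holds off the support of `β`. -/
lemma Potentials.integral_gibbs {α β : Prob d} {f g : Euc d → ℝ} (h : Potentials ε α β f g)
    (β' : Prob d) :
    Integrable (gibbs ε f g) ((α : Measure (Euc d)).prod (β' : Measure (Euc d))) ∧
    ∫ p, gibbs ε f g p ∂(α : Measure (Euc d)).prod (β' : Measure (Euc d)) = 1 := by
  have hm : Measurable (gibbs ε f g) := measurable_gibbs h.meas_left h.meas_right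
  have hl : ∫⁻ p, ENNReal.ofReal (gibbs ε f g p)
      ∂(α : Measure (Euc d)).prod (β' : Measure (Euc d)) = 1 := by
    rw [lintegral_prod_symm' _ (by fun_prop)]
    simp_rw [h.lintegral_gibbs_left]
    simp
  have hpos : 0 ≤ᵐ[(α : Measure (Euc d)).prod (β' : Measure (Euc d))] gibbs ε f g :=
    Eventually.of_forall fun p => (gibbs_pos f g p).le
  refine ⟨⟨hm.aestronglyMeasurable, ?_⟩, ?_⟩
  · rw [hasFiniteIntegral_iff_ofReal hpos, hl]
    simp
  · rw [integral_eq_lintegral_of_nonneg_ae hpos hm.aestronglyMeasurable, hl]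
    simp

lemma coupling_integral {α β : Prob d} {π : Measure (Euc d × Euc d)} (hπ : π ∈ couplings α β)
    {f g : Euc d → ℝ} (hf : Integrable f (α : Measure (Euc d)))
    (hg : Integrable g (β : Measure (Euc d))) :
    Integrable (fun p => f p.1 + g p.2) π ∧
    ∫ p, f p.1 + g p.2 ∂π = ∫ x, f x ∂(α : Measure (Euc d)) + ∫ y, g y ∂(β : Measure (Euc d)) := by
  obtain ⟨h1, h2⟩ := hπ
  rw [← h1] at hf ⊢
  rw [← h2] at hg ⊢
  have hf' : Integrable (fun p : Euc d × Euc d => f p.1) π :=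
    hf.comp_aemeasurable measurable_fst.aemeasurable
  have hg' : Integrable (fun p : Euc d × Euc d => g p.2) π :=
    hg.comp_aemeasurable measurable_snd.aemeasurable
  refine ⟨hf'.add hg', ?_⟩
  rw [integral_add hf' hg', integral_map measurable_fst.aemeasurable hf.aestronglyMeasurable,
    integral_map measurable_snd.aemeasurable hg.aestronglyMeasurable]

lemma isProbabilityMeasure_of_coupling {α β : Prob d} {π : Measure (Euc d × Euc d)}
    (hπ : π ∈ couplings α β) : IsProbabilityMeasure π := by
  constructor
  have : π.map Prod.fst univ = 1 := by rw [hπ.1]; simp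
  rwa [Measure.map_apply measurable_fst MeasurableSet.univ, preimage_univ] at this

/-- The cost and the entropy of an absolutely continuous coupling as one integral against the
product of the marginals. -/
lemma transport_eq (hε : 0 < ε) {α β : Prob d} {π : Measure (Euc d × Euc d)} [IsFiniteMeasure π]
    (hac : π ≪ (α : Measure (Euc d)).prod (β : Measure (Euc d))) :
    (∫⁻ p, ENNReal.ofReal (cost p.1 p.2) ∂π) + ENNReal.ofReal ε *
      klDiv π ((α : Measure (Euc d)).prod (β : Measure (Euc d))) =
    ∫⁻ p, ENNReal.ofReal
      ((π.rnDeriv ((α : Measure (Euc d)).prod (β : Measure (Euc d))) p).toReal * cost p.1 p.2 +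
        ε * klFun (π.rnDeriv ((α : Measure (Euc d)).prod (β : Measure (Euc d))) p).toReal)
      ∂(α : Measure (Euc d)).prod (β : Measure (Euc d)) := by
  set ν := (α : Measure (Euc d)).prod (β : Measure (Euc d))
  have hc : Measurable fun p : Euc d × Euc d => cost p.1 p.2 := measurable_cost
  have hk : Measurable klFun := measurable_klFun
  have hρ : Measurable (π.rnDeriv ν) := Measure.measurable_rnDeriv _ _
  rw [klDiv_eq_lintegral_klFun_of_ac hac, ← lintegral_rnDeriv_mul hac (by fun_prop),
    ← lintegral_const_mul _ (by fun_prop), ← lintegral_add_left (by fun_prop)]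
  refine lintegral_congr_ae ?_
  filter_upwards [Measure.rnDeriv_lt_top π ν] with p hp
  have hcp : 0 ≤ cost p.1 p.2 := sq_nonneg _
  rw [ENNReal.ofReal_add (by positivity)
      (mul_nonneg hε.le (klFun_nonneg ENNReal.toReal_nonneg)), ENNReal.ofReal_mul hε.le,
    ENNReal.ofReal_mul ENNReal.toReal_nonneg, ENNReal.ofReal_toReal hp.ne]

lemma ofReal_integral_le_lintegral {X : Type*} [MeasurableSpace X] {μ : Measure X} {F : X → ℝ}
    (hF : Integrable F μ) : ENNReal.ofReal (∫ x, F x ∂μ) ≤ ∫⁻ x, ENNReal.ofReal (F x) ∂μ := by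
  have h1 : ∀ x, ENNReal.ofReal (F x) = ENNReal.ofReal (max (F x) 0) := fun x => by simp
  simp_rw [h1]
  rw [← ofReal_integral_eq_lintegral_ofReal hF.pos_part
    (Eventually.of_forall fun x => le_max_right _ _)]
  exact ENNReal.ofReal_le_ofReal (integral_mono hF hF.pos_part fun x => le_max_left _ _)

/-- Young's inequality for the entropy function and its convex conjugate. -/
lemma mul_add_one_sub_exp_le_klFun {x : ℝ} (hx : 0 ≤ x) (u : ℝ) :
    x * u + 1 - Real.exp u ≤ klFun x := by
  rcases hx.eq_or_lt with rfl | hx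
  · simp [klFun_zero, (Real.exp_pos u).le]
  · have h1 := mul_le_mul_of_nonneg_left (Real.add_one_le_exp (u - Real.log x)) hx.le
    rw [Real.exp_sub, Real.exp_log hx, mul_div_cancel₀ _ hx.ne'] at h1
    rw [klFun_apply]
    linarith

/-- The entropy function is controlled by the chi-square divergence. -/
lemma klFun_le_chiSq {x : ℝ} (hx : 0 ≤ x) (u : ℝ) :
    klFun x ≤ x * u + (x - Real.exp u) ^ 2 / Real.exp u + 1 - Real.exp u := by
  have hu := Real.exp_pos u
  have e : (x - Real.exp u) ^ 2 / Real.exp u = x * (x / Real.exp u) - 2 * x + Real.exp u := by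
    field_simp
    ring
  rw [e]
  rcases hx.eq_or_lt with rfl | hx
  · simp [klFun_zero]
  · have h1 := Real.log_le_sub_one_of_pos (div_pos hx hu)
    rw [Real.log_div hx.ne' hu.ne', Real.log_exp] at h1
    have := mul_le_mul_of_nonneg_left h1 hx.le
    rw [klFun_apply]
    linarith

/-- Weak duality. -/
lemma ofReal_dual_le_entropicCost (hε : 0 < ε) {α β : Prob d} {f g : Euc d → ℝ}
    (hf : Integrable f (α : Measure (Euc d))) (hg : Integrable g (β : Measure (Euc d)))
    (hint : Integrable (gibbs ε f g) ((α : Measure (Euc d)).prod (β : Measure (Euc d)))) :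
    ENNReal.ofReal (∫ x, f x ∂(α : Measure (Euc d)) + ∫ y, g y ∂(β : Measure (Euc d)) +
      ε * (1 - ∫ p, gibbs ε f g p ∂(α : Measure (Euc d)).prod (β : Measure (Euc d)))) ≤
    entropicCost ε α β := by
  refine le_iInf₂ fun π hπ => ?_
  have := isProbabilityMeasure_of_coupling hπ
  by_cases hac : π ≪ (α : Measure (Euc d)).prod (β : Measure (Euc d))
  swap
  · rw [klDiv_of_not_ac hac, ENNReal.mul_top (by simpa using hε)]
    simp
  rw [transport_eq hε hac]
  set ν := (α : Measure (Euc d)).prod (β : Measure (Euc d))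
  obtain ⟨h1, h2⟩ := coupling_integral hπ hf hg
  have h3 : Integrable (fun p => (π.rnDeriv ν p).toReal * (f p.1 + g p.2)) ν :=
    (integrable_rnDeriv_smul_iff hac).2 h1
  have h4 : ∫ p, (π.rnDeriv ν p).toReal * (f p.1 + g p.2) ∂ν = ∫ p, f p.1 + g p.2 ∂π :=
    integral_rnDeriv_smul hac
  have h5 : Integrable (fun p => ε * (1 - gibbs ε f g p)) ν :=
    ((integrable_const 1).sub hint).const_mul ε
  have h6 : ∫ p, ε * (1 - gibbs ε f g p) ∂ν = ε * (1 - ∫ p, gibbs ε f g p ∂ν) := by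
    rw [integral_const_mul, integral_sub (integrable_const 1) hint]
    simp
  rw [← h2, ← h4, ← h6, ← integral_add h3 h5]
  refine (ofReal_integral_le_lintegral (h3.add h5)).trans
    (lintegral_mono fun p => ENNReal.ofReal_le_ofReal ?_)
  have h7 := mul_le_mul_of_nonneg_left (mul_add_one_sub_exp_le_klFun
    (ENNReal.toReal_nonneg (a := π.rnDeriv ν p)) ((f p.1 + g p.2 - cost p.1 p.2) / ε)) hε.le
  have h8 : ε * ((π.rnDeriv ν p).toReal * ((f p.1 + g p.2 - cost p.1 p.2) / ε) + 1 -
      Real.exp ((f p.1 + g p.2 - cost p.1 p.2) / ε)) = (π.rnDeriv ν p).toReal *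
      (f p.1 + g p.2 - cost p.1 p.2) + ε * (1 - gibbs ε f g p) := by
    rw [gibbs]; field_simp; ring
  rw [h8] at h7
  simp only [Pi.add_apply]
  linarith

/-- The coupling with density `ρ` with respect to `α ⊗ β`. -/
lemma withDensity_mem_couplings {α β : Prob d} {ρ : Euc d × Euc d → ℝ≥0∞} (hρ : Measurable ρ)
    (h1 : ∀ᵐ x ∂(α : Measure (Euc d)), ∫⁻ y, ρ (x, y) ∂(β : Measure (Euc d)) = 1)
    (h2 : ∀ᵐ y ∂(β : Measure (Euc d)), ∫⁻ x, ρ (x, y) ∂(α : Measure (Euc d)) = 1) :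
    ((α : Measure (Euc d)).prod (β : Measure (Euc d))).withDensity ρ ∈ couplings α β := by
  constructor
  · refine Measure.ext_of_lintegral _ fun φ hφ => ?_
    rw [lintegral_map hφ measurable_fst, lintegral_withDensity_eq_lintegral_mul _ hρ (by fun_prop),
      lintegral_prod _ (by fun_prop)]
    refine lintegral_congr_ae ?_
    filter_upwards [h1] with x hx
    simp only [Pi.mul_apply]
    rw [lintegral_mul_const _ (by fun_prop), hx, one_mul]
  · refine Measure.ext_of_lintegral _ fun φ hφ => ?_
    rw [lintegral_map hφ measurable_snd, lintegral_withDensity_eq_lintegral_mul _ hρ (by fun_prop),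
      lintegral_prod_symm' _ (by fun_prop)]
    refine lintegral_congr_ae ?_
    filter_upwards [h2] with y hy
    simp only [Pi.mul_apply]
    rw [lintegral_mul_const _ (by fun_prop), hy, one_mul]

/-- A coupling with density `ρ` costs at most the dual value of `(f, g)` plus `ε` times the
chi-square divergence of `ρ` from the Gibbs density. -/
lemma entropicCost_le_chiSq (hε : 0 < ε) {α β : Prob d} {f g : Euc d → ℝ}
    (hf : Integrable f (α : Measure (Euc d))) (hg : Integrable g (β : Measure (Euc d)))
    (hint : Integrable (gibbs ε f g) ((α : Measure (Euc d)).prod (β : Measure (Euc d))))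
    (hone : ∫ p, gibbs ε f g p ∂(α : Measure (Euc d)).prod (β : Measure (Euc d)) = 1)
    {ρ : Euc d × Euc d → ℝ} (hρ : Measurable ρ) (hρ0 : ∀ p, 0 ≤ ρ p)
    (h1 : ∀ᵐ x ∂(α : Measure (Euc d)), ∫⁻ y, ENNReal.ofReal (ρ (x, y)) ∂(β : Measure (Euc d)) = 1)
    (h2 : ∀ᵐ y ∂(β : Measure (Euc d)), ∫⁻ x, ENNReal.ofReal (ρ (x, y)) ∂(α : Measure (Euc d)) = 1)
    (hχ : Integrable (fun p => (ρ p - gibbs ε f g p) ^ 2 / gibbs ε f g p)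
      ((α : Measure (Euc d)).prod (β : Measure (Euc d)))) :
    entropicCost ε α β ≠ ∞ ∧
    OT ε α β ≤ ∫ x, f x ∂(α : Measure (Euc d)) + ∫ y, g y ∂(β : Measure (Euc d)) +
      ε * ∫ p, (ρ p - gibbs ε f g p) ^ 2 / gibbs ε f g p
        ∂(α : Measure (Euc d)).prod (β : Measure (Euc d)) := by
  set ν := (α : Measure (Euc d)).prod (β : Measure (Euc d))
  set π := ν.withDensity fun p => ENNReal.ofReal (ρ p)
  have hπ : π ∈ couplings α β := withDensity_mem_couplings (by fun_prop) h1 h2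
  have := isProbabilityMeasure_of_coupling hπ
  have hac : π ≪ ν := withDensity_absolutelyContinuous _ _
  have hrn : ∀ᵐ p ∂ν, (π.rnDeriv ν p).toReal = ρ p := by
    filter_upwards [Measure.rnDeriv_withDensity ν (f := fun p => ENNReal.ofReal (ρ p))
      (by fun_prop)] with p hp
    rw [hp, ENNReal.toReal_ofReal (hρ0 p)]
  obtain ⟨c1, c2⟩ := coupling_integral hπ hf hg
  have h3 : Integrable (fun p => (π.rnDeriv ν p).toReal * (f p.1 + g p.2)) ν :=
    (integrable_rnDeriv_smul_iff hac).2 c1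
  have h4 : ∫ p, (π.rnDeriv ν p).toReal * (f p.1 + g p.2) ∂ν = ∫ p, f p.1 + g p.2 ∂π :=
    integral_rnDeriv_smul hac
  have h5 : Integrable (fun p => ε * (1 - gibbs ε f g p)) ν :=
    ((integrable_const 1).sub hint).const_mul ε
  have h6 : ∫ p, ε * (1 - gibbs ε f g p) ∂ν = 0 := by
    rw [integral_const_mul, integral_sub (integrable_const 1) hint, hone]
    simp
  have h7 := hχ.const_mul ε
  set G : Euc d × Euc d → ℝ := fun p => (π.rnDeriv ν p).toReal * (f p.1 + g p.2) +
    ε * (1 - gibbs ε f g p) + ε * ((ρ p - gibbs ε f g p) ^ 2 / gibbs ε f g p)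
  have hG : Integrable G ν := (h3.add h5).add h7
  have hGint : ∫ p, G p ∂ν = ∫ x, f x ∂(α : Measure (Euc d)) + ∫ y, g y ∂(β : Measure (Euc d)) +
      ε * ∫ p, (ρ p - gibbs ε f g p) ^ 2 / gibbs ε f g p ∂ν := by
    refine (integral_add (h3.add h5) h7).trans ?_
    rw [integral_add' h3 h5, h4, h6, c2, integral_const_mul, add_zero]
  have hle : ∀ᵐ p ∂ν, (π.rnDeriv ν p).toReal * cost p.1 p.2 +
      ε * klFun (π.rnDeriv ν p).toReal ≤ G p := by
    filter_upwards [hrn] with p hp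
    have h8 := mul_le_mul_of_nonneg_left (klFun_le_chiSq (hρ0 p)
      ((f p.1 + g p.2 - cost p.1 p.2) / ε)) hε.le
    have h9 : ε * (ρ p * ((f p.1 + g p.2 - cost p.1 p.2) / ε) +
        (ρ p - Real.exp ((f p.1 + g p.2 - cost p.1 p.2) / ε)) ^ 2 /
          Real.exp ((f p.1 + g p.2 - cost p.1 p.2) / ε) + 1 -
        Real.exp ((f p.1 + g p.2 - cost p.1 p.2) / ε)) =
        ρ p * (f p.1 + g p.2 - cost p.1 p.2) + ε * (1 - gibbs ε f g p) +
          ε * ((ρ p - gibbs ε f g p) ^ 2 / gibbs ε f g p) := by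
      rw [gibbs]; field_simp; ring
    rw [h9] at h8
    simp only [G]
    rw [hp]
    linarith
  have hG0 : 0 ≤ᵐ[ν] G := by
    filter_upwards [hle] with p hp
    refine le_trans (add_nonneg (mul_nonneg ENNReal.toReal_nonneg (sq_nonneg _))
      (mul_nonneg hε.le (klFun_nonneg ENNReal.toReal_nonneg))) hp
  have hcost : entropicCost ε α β ≤ ENNReal.ofReal (∫ p, G p ∂ν) := by
    refine (iInf₂_le π hπ).trans ?_
    rw [transport_eq hε hac, ofReal_integral_eq_lintegral_ofReal hG hG0]
    refine lintegral_mono_ae ?_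
    filter_upwards [hle] with p hp
    exact ENNReal.ofReal_le_ofReal hp
  refine ⟨(hcost.trans_lt ENNReal.ofReal_lt_top).ne, ?_⟩
  rw [← hGint, OT]
  exact ENNReal.toReal_le_of_le_ofReal (integral_nonneg_of_ae hG0) hcost

lemma Potentials.integrable_left {α β : Prob d} {f g : Euc d → ℝ} (h : Potentials ε α β f g)
    {μ : Prob d} (hμ : μ ∈ subGaussian d) : Integrable f (μ : Measure (Euc d)) :=
  h.growth_left.integrable h.meas_left hμ

lemma Potentials.integrable_right {α β : Prob d} {f g : Euc d → ℝ} (h : Potentials ε α β f g)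
    {μ : Prob d} (hμ : μ ∈ subGaussian d) : Integrable g (μ : Measure (Euc d)) :=
  h.growth_right.integrable h.meas_right hμ

lemma Potentials.upper (hε : 0 < ε) {α β : Prob d} (hα : α ∈ subGaussian d)
    (hβ : β ∈ subGaussian d) {f g : Euc d → ℝ} (h : Potentials ε α β f g) :
    entropicCost ε α β ≠ ∞ ∧
    OT ε α β ≤ ∫ x, f x ∂(α : Measure (Euc d)) + ∫ y, g y ∂(β : Measure (Euc d)) := by
  obtain ⟨h1, h2⟩ := h.integral_gibbs β
  have := entropicCost_le_chiSq hε (h.integrable_left hα) (h.integrable_right hβ) h1 h2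
    (measurable_gibbs h.meas_left h.meas_right) (fun p => (gibbs_pos f g p).le)
    (Eventually.of_forall h.lintegral_gibbs_right) (Eventually.of_forall h.lintegral_gibbs_left)
    (by simp)
  simpa using this

lemma entropicCost_ne_top (hε : 0 < ε) {α β : Prob d} (hα : α ∈ subGaussian d)
    (hβ : β ∈ subGaussian d) : entropicCost ε α β ≠ ∞ := by
  obtain ⟨f, g, h⟩ := exists_potentials hε hα hβ
  exact (h.upper hε hα hβ).1

lemma dual_le_OT (hε : 0 < ε) {α β : Prob d} (hα : α ∈ subGaussian d)
    (hβ : β ∈ subGaussian d) {f g : Euc d → ℝ}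
    (hf : Integrable f (α : Measure (Euc d))) (hg : Integrable g (β : Measure (Euc d)))
    (hint : Integrable (gibbs ε f g) ((α : Measure (Euc d)).prod (β : Measure (Euc d)))) :
    ∫ x, f x ∂(α : Measure (Euc d)) + ∫ y, g y ∂(β : Measure (Euc d)) +
      ε * (1 - ∫ p, gibbs ε f g p ∂(α : Measure (Euc d)).prod (β : Measure (Euc d))) ≤
    OT ε α β :=
  (ENNReal.ofReal_le_iff_le_toReal (entropicCost_ne_top hε hα hβ)).1
    (ofReal_dual_le_entropicCost hε hf hg hint)

/-- The potentials of `(α, β)` bound `OT_ε(α, ·)` from below at every sub-Gaussian measure. -/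
lemma Potentials.le_OT (hε : 0 < ε) {α β β' : Prob d} (hα : α ∈ subGaussian d)
    (hβ' : β' ∈ subGaussian d) {f g : Euc d → ℝ} (h : Potentials ε α β f g) :
    ∫ x, f x ∂(α : Measure (Euc d)) + ∫ y, g y ∂(β' : Measure (Euc d)) ≤ OT ε α β' := by
  obtain ⟨h1, h2⟩ := h.integral_gibbs β'
  have := dual_le_OT hε hα hβ' (h.integrable_left hα) (h.integrable_right hβ') h1
  rw [h2] at this
  linarith

lemma Potentials.OT_eq (hε : 0 < ε) {α β : Prob d} (hα : α ∈ subGaussian d)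
    (hβ : β ∈ subGaussian d) {f g : Euc d → ℝ} (h : Potentials ε α β f g) :
    OT ε α β = ∫ x, f x ∂(α : Measure (Euc d)) + ∫ y, g y ∂(β : Measure (Euc d)) :=
  le_antisymm (h.upper hε hα hβ).2 (h.le_OT hε hα hβ)

/-! ### Symmetric potentials -/

lemma Potentials.integral_gibbs_mul {α β : Prob d} {f g : Euc d → ℝ}
    (h : Potentials ε α β f g) {φ ψ : Euc d → ℝ} (hφ : Integrable φ (α : Measure (Euc d)))
    (hψ : Integrable ψ (β : Measure (Euc d))) :
    Integrable (fun p => gibbs ε f g p * (φ p.1 + ψ p.2))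
      ((α : Measure (Euc d)).prod (β : Measure (Euc d))) ∧
    ∫ p, gibbs ε f g p * (φ p.1 + ψ p.2) ∂(α : Measure (Euc d)).prod (β : Measure (Euc d)) =
      ∫ x, φ x ∂(α : Measure (Euc d)) + ∫ y, ψ y ∂(β : Measure (Euc d)) := by
  have hm : Measurable fun p => ENNReal.ofReal (gibbs ε f g p) :=
    (measurable_gibbs h.meas_left h.meas_right).ennreal_ofReal
  have hlt : ∀ᵐ p ∂(α : Measure (Euc d)).prod (β : Measure (Euc d)),
      ENNReal.ofReal (gibbs ε f g p) < ∞ := Eventually.of_forall fun p => ENNReal.ofReal_lt_top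
  obtain ⟨h1, h2⟩ := coupling_integral (withDensity_mem_couplings hm
    (Eventually.of_forall h.lintegral_gibbs_right) (Eventually.of_forall h.lintegral_gibbs_left))
    hφ hψ
  rw [integrable_withDensity_iff_integrable_smul' hm hlt] at h1
  rw [integral_withDensity_eq_integral_toReal_smul hm hlt] at h2
  simp only [ENNReal.toReal_ofReal (gibbs_pos f g _).le, smul_eq_mul] at h1 h2
  exact ⟨h1, h2⟩

/-- The potentials of `(α, α)` differ by a constant: both `(f, g)` and `(g, f)` solve the
equations, and the symmetrized relative entropy of the two Gibbs densities vanishes because their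
marginals agree. -/
lemma Potentials.ae_sub_eq_const {α : Prob d} (hε : 0 < ε) (hα : α ∈ subGaussian d)
    {f g : Euc d → ℝ} (h : Potentials ε α α f g) :
    ∃ c : ℝ, ∀ᵐ x ∂(α : Measure (Euc d)), f x - g x = c := by
  have hθ : Integrable (fun x => f x - g x) (α : Measure (Euc d)) :=
    (h.integrable_left hα).sub (h.integrable_right hα)
  obtain ⟨i1, e1⟩ := h.integral_gibbs_mul hθ hθ.neg
  obtain ⟨i2, e2⟩ := h.symm.integral_gibbs_mul hθ hθ.neg
  have hzero : ∫ p, gibbs ε f g p * ((f p.1 - g p.1) + -(f p.2 - g p.2)) -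
      gibbs ε g f p * ((f p.1 - g p.1) + -(f p.2 - g p.2))
      ∂(α : Measure (Euc d)).prod (α : Measure (Euc d)) = 0 := by
    refine (integral_sub i1 i2).trans ?_
    rw [e1, e2, sub_self]
  have hnn : ∀ p : Euc d × Euc d, 0 ≤ gibbs ε f g p * ((f p.1 - g p.1) + -(f p.2 - g p.2)) -
      gibbs ε g f p * ((f p.1 - g p.1) + -(f p.2 - g p.2)) := fun p => by
    rw [← sub_mul]
    rcases le_total (f p.2 - g p.2) (f p.1 - g p.1) with hle | hle
    · refine mul_nonneg (sub_nonneg.2 (Real.exp_le_exp.2 ?_)) (by linarith)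
      exact div_le_div_of_nonneg_right (by linarith) hε.le
    · refine mul_nonneg_of_nonpos_of_nonpos (sub_nonpos.2 (Real.exp_le_exp.2 ?_)) (by linarith)
      exact div_le_div_of_nonneg_right (by linarith) hε.le
  have hae := (integral_eq_zero_iff_of_nonneg hnn (i1.sub i2)).1 hzero
  have hconst : ∀ᵐ p ∂(α : Measure (Euc d)).prod (α : Measure (Euc d)),
      f p.1 - g p.1 = f p.2 - g p.2 := by
    filter_upwards [hae] with p hp
    simp only [Pi.zero_apply, ← sub_mul, mul_eq_zero] at hp
    rcases hp with hp | hp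
    · have h1 := Real.exp_injective (sub_eq_zero.1 hp)
      rw [div_left_inj' hε.ne'] at h1
      linarith
    · linarith
  obtain ⟨x, hx⟩ := (Measure.ae_ae_of_ae_prod hconst).exists
  exact ⟨f x - g x, hx.mono fun y hy => hy.symm⟩

lemma exists_symmetric_potential (hε : 0 < ε) {α : Prob d} (hα : α ∈ subGaussian d) :
    ∃ h : Euc d → ℝ, Potentials ε α α h h := by
  obtain ⟨f, g, hP⟩ := exists_potentials hε hα hα
  obtain ⟨c, hc⟩ := hP.ae_sub_eq_const hε hα
  set h : Euc d → ℝ := fun x => (f x + g x) / 2 with hh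
  have hfm := hP.meas_left
  have hgm := hP.meas_right
  have hm : Measurable h := by fun_prop
  -- almost everywhere `h = f - c / 2 = g + c / 2`, so `𝒦(exp (h / ε) α)` is known in two ways
  have hshift : ∀ (φ ψ : Euc d → ℝ) (t : ℝ), Measurable φ →
      IsSoftTransform ε (α : Measure (Euc d)) φ ψ →
      (∀ᵐ x ∂(α : Measure (Euc d)), h x = φ x + t) → ∀ x,
      gop ε (α : Measure (Euc d)) (fun y => ENNReal.ofReal (Real.exp (h y / ε))) x =
        ENNReal.ofReal (Real.exp (-(ψ x - t) / ε)) := by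
    intro φ ψ t hφ hsoft hae x
    calc gop ε (α : Measure (Euc d)) (fun y => ENNReal.ofReal (Real.exp (h y / ε))) x
        = ∫⁻ y, ENNReal.ofReal (Real.exp (t / ε)) *
            (gker ε x y * ENNReal.ofReal (Real.exp (φ y / ε))) ∂(α : Measure (Euc d)) := by
          refine lintegral_congr_ae ?_
          filter_upwards [hae] with y hy
          rw [hy, add_div, Real.exp_add, ENNReal.ofReal_mul (Real.exp_pos _).le]
          ring
      _ = ENNReal.ofReal (Real.exp (t / ε)) * ENNReal.ofReal (Real.exp (-ψ x / ε)) := by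
          rw [lintegral_const_mul _ (by fun_prop), ← hsoft x]
          rfl
      _ = _ := by
          rw [← ENNReal.ofReal_mul (Real.exp_pos _).le, ← Real.exp_add, ← add_div]
          ring_nf
  have h1 := hshift f g (-(c / 2)) hfm hP.right
    (by filter_upwards [hc] with x hx; simp only [hh]; linarith)
  have h2 := hshift g f (c / 2) hgm hP.left
    (by filter_upwards [hc] with x hx; simp only [hh]; linarith)
  have hsoft : IsSoftTransform ε (α : Measure (Euc d)) h h := fun x => by
    have h3 := h1 x
    rw [h2 x, ENNReal.ofReal_eq_ofReal_iff (Real.exp_pos _).le (Real.exp_pos _).le] at h3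
    have h4 := Real.exp_injective h3
    rw [div_left_inj' hε.ne'] at h4
    rw [h2 x, show h x = f x - c / 2 by simp only [hh]; linarith]
  exact ⟨h, IsSoftTransform.potentials hε hα hα hm hm hsoft hsoft⟩

/-! ### Positive definiteness of the Gaussian kernel -/

/-- The convolution square root of the Gaussian kernel, up to a constant. -/
def gsqrt (ε : ℝ) (z x : Euc d) : ℝ≥0∞ := ENNReal.ofReal (Real.exp (-(2 / ε) * ‖x - z‖ ^ 2))

/-- The normalizing constant of the convolution square root. -/
def gconst (ε : ℝ) (d : ℕ) : ℝ≥0∞ :=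
  ∫⁻ w : Euc d, ENNReal.ofReal (Real.exp (-(4 / ε) * ‖w‖ ^ 2))

@[fun_prop]
lemma measurable_gsqrt_comp {X : Type*} [MeasurableSpace X] {f g : X → Euc d} (hf : Measurable f)
    (hg : Measurable g) : Measurable fun x => gsqrt ε (f x) (g x) := by
  unfold gsqrt; fun_prop

lemma gconst_ne_zero_and_ne_top (hε : 0 < ε) : gconst ε d ≠ 0 ∧ gconst ε d ≠ ∞ := by
  have h4 : 0 < 4 / ε := by positivity
  have hval := GaussianFourier.integral_rexp_neg_mul_sq_norm (V := Euc d) h4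
  have hpos : 0 < (Real.pi / (4 / ε)) ^ (Module.finrank ℝ (Euc d) / 2 : ℝ) := by positivity
  have hint : Integrable fun w : Euc d => Real.exp (-(4 / ε) * ‖w‖ ^ 2) := by
    by_contra hn
    rw [integral_undef hn] at hval
    exact hpos.ne hval
  have : gconst ε d =
      ENNReal.ofReal ((Real.pi / (4 / ε)) ^ (Module.finrank ℝ (Euc d) / 2 : ℝ)) := by
    rw [gconst, ← ofReal_integral_eq_lintegral_ofReal hint
      (Eventually.of_forall fun w => (Real.exp_pos _).le), hval]
  rw [this]
  exact ⟨by simpa using hpos, ENNReal.ofReal_ne_top⟩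

lemma lintegral_gsqrt_mul_gsqrt (x y : Euc d) :
    ∫⁻ z, gsqrt ε z x * gsqrt ε z y = gconst ε d * gker ε x y := by
  have key : ∀ z : Euc d, ‖x - z‖ ^ 2 + ‖y - z‖ ^ 2 =
      2 * ‖z - (1 / 2 : ℝ) • (x + y)‖ ^ 2 + ‖x - y‖ ^ 2 / 2 := by
    intro z
    have hp := parallelogram_law_with_norm ℝ (x - z) (y - z)
    have e1 : x - z + (y - z) = (-2 : ℝ) • (z - (1 / 2 : ℝ) • (x + y)) := by
      module
    have e2 : x - z - (y - z) = x - y := by abel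
    rw [e1, e2, norm_smul] at hp
    norm_num at hp
    norm_num
    linarith
  have h1 : ∀ z, gsqrt ε z x * gsqrt ε z y =
      ENNReal.ofReal (Real.exp (-(4 / ε) * ‖z - (1 / 2 : ℝ) • (x + y)‖ ^ 2)) * gker ε x y := by
    intro z
    rw [gsqrt, gsqrt, gker, ← ENNReal.ofReal_mul (Real.exp_pos _).le,
      ← ENNReal.ofReal_mul (Real.exp_pos _).le, ← Real.exp_add, ← Real.exp_add, ← mul_add, key,
      cost]
    congr 2
    ring
  simp_rw [h1]
  rw [lintegral_mul_const _ (by fun_prop), gconst,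
    lintegral_sub_right_eq_self (fun w : Euc d => ENNReal.ofReal (Real.exp (-(4 / ε) * ‖w‖ ^ 2)))]

lemma gconst_mul_lintegral_mul_gop (μ ν : Measure (Euc d)) [SFinite μ] [SFinite ν]
    {φ ψ : Euc d → ℝ≥0∞} (hφ : Measurable φ) (hψ : Measurable ψ) :
    gconst ε d * ∫⁻ x, φ x * gop ε ν ψ x ∂μ =
      ∫⁻ z, (∫⁻ x, gsqrt ε z x * φ x ∂μ) * ∫⁻ y, gsqrt ε z y * ψ y ∂ν := by
  have hΨ : Measurable fun z => ∫⁻ y, gsqrt ε z y * ψ y ∂ν :=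
    Measurable.lintegral_prod_right' (f := fun p : Euc d × Euc d => gsqrt ε p.1 p.2 * ψ p.2)
      (by fun_prop)
  have hinner : ∀ x, gconst ε d * gop ε ν ψ x =
      ∫⁻ z, gsqrt ε z x * ∫⁻ y, gsqrt ε z y * ψ y ∂ν := fun x => by
    have e1 : ∀ y, gconst ε d * (gker ε x y * ψ y) =
        ∫⁻ z, gsqrt ε z x * (gsqrt ε z y * ψ y) := fun y => by
      rw [← mul_assoc, ← lintegral_gsqrt_mul_gsqrt, ← lintegral_mul_const _ (by fun_prop)]
      simp_rw [mul_assoc]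
    have e2 : ∀ z, gsqrt ε z x * ∫⁻ y, gsqrt ε z y * ψ y ∂ν =
        ∫⁻ y, gsqrt ε z x * (gsqrt ε z y * ψ y) ∂ν := fun z => by
      rw [lintegral_const_mul _ (by fun_prop)]
    rw [gop, ← lintegral_const_mul _ (by fun_prop)]
    simp_rw [e1, e2]
    exact lintegral_lintegral_swap (Measurable.aemeasurable (by fun_prop))
  have e3 : ∀ x, gconst ε d * (φ x * gop ε ν ψ x) =
      ∫⁻ z, gsqrt ε z x * φ x * ∫⁻ y, gsqrt ε z y * ψ y ∂ν := fun x => by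
    rw [mul_left_comm, hinner, ← lintegral_const_mul _ (by fun_prop)]
    refine lintegral_congr fun z => by ring
  have e4 : ∀ z, (∫⁻ x, gsqrt ε z x * φ x ∂μ) * ∫⁻ y, gsqrt ε z y * ψ y ∂ν =
      ∫⁻ x, gsqrt ε z x * φ x * ∫⁻ y, gsqrt ε z y * ψ y ∂ν ∂μ := fun z => by
    rw [lintegral_mul_const _ (by fun_prop)]
  have hop := measurable_gop (ε := ε) ν hψ
  rw [← lintegral_const_mul _ (by fun_prop)]
  simp_rw [e3, e4]
  exact lintegral_lintegral_swap (Measurable.aemeasurable (by fun_prop))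

lemma ennreal_two_mul_le (a b : ℝ≥0∞) : 2 * (a * b) ≤ a * a + b * b := by
  induction a with
  | top => simp
  | coe a =>
    induction b with
    | top => simp
    | coe b =>
      norm_cast
      have h := two_mul_le_add_sq a b
      calc 2 * (a * b) = 2 * a * b := by ring
        _ ≤ a ^ 2 + b ^ 2 := h
        _ = _ := by ring

/-- Positive definiteness of the Gaussian kernel. -/
lemma two_mul_lintegral_mul_gop_le (hε : 0 < ε) (μ ν : Measure (Euc d)) [SFinite μ] [SFinite ν]
    {φ ψ : Euc d → ℝ≥0∞} (hφ : Measurable φ) (hψ : Measurable ψ) :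
    2 * ∫⁻ x, φ x * gop ε ν ψ x ∂μ ≤
      ∫⁻ x, φ x * gop ε μ φ x ∂μ + ∫⁻ x, ψ x * gop ε ν ψ x ∂ν := by
  obtain ⟨h0, ht⟩ := gconst_ne_zero_and_ne_top (d := d) hε
  rw [← ENNReal.mul_le_mul_iff_right h0 ht, mul_left_comm, mul_add,
    gconst_mul_lintegral_mul_gop _ _ hφ hψ, gconst_mul_lintegral_mul_gop _ _ hφ hφ,
    gconst_mul_lintegral_mul_gop _ _ hψ hψ]
  have hΨ : Measurable fun z => ∫⁻ y, gsqrt ε z y * ψ y ∂ν :=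
    Measurable.lintegral_prod_right' (f := fun p : Euc d × Euc d => gsqrt ε p.1 p.2 * ψ p.2)
      (by fun_prop)
  have hΦ : Measurable fun z => ∫⁻ x, gsqrt ε z x * φ x ∂μ :=
    Measurable.lintegral_prod_right' (f := fun p : Euc d × Euc d => gsqrt ε p.1 p.2 * φ p.2)
      (by fun_prop)
  rw [← lintegral_add_left (by fun_prop), ← lintegral_const_mul _ (by fun_prop)]
  exact lintegral_mono fun z => ennreal_two_mul_le _ _

/-- Convexity of `β ↦ -OT_ε(β, β) / 2` in the form of a tangent inequality: by positive
definiteness of the kernel, `∫ exp ((h' - h) / ε) dβ ≤ 1`, and Jensen's inequality concludes. -/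
lemma Potentials.integral_symmetric_le (hε : 0 < ε) {α β : Prob d}
    (hβ : β ∈ subGaussian d) {h h' : Euc d → ℝ} (hP : Potentials ε α α h h)
    (hP' : Potentials ε β β h' h') :
    ∫ x, h' x ∂(β : Measure (Euc d)) ≤ ∫ x, h x ∂(β : Measure (Euc d)) := by
  have hm := hP.meas_left
  have hm' := hP'.meas_left
  have hself : ∀ {μ : Prob d} {k : Euc d → ℝ}, IsSoftTransform ε (μ : Measure (Euc d)) k k →
      ∫⁻ x, ENNReal.ofReal (Real.exp (k x / ε)) * gop ε (μ : Measure (Euc d))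
        (fun y => ENNReal.ofReal (Real.exp (k y / ε))) x ∂(μ : Measure (Euc d)) = 1 := by
    intro μ k hk
    have : ∀ x, ENNReal.ofReal (Real.exp (k x / ε)) * gop ε (μ : Measure (Euc d))
        (fun y => ENNReal.ofReal (Real.exp (k y / ε))) x = 1 := fun x => by
      rw [hk x, ← ENNReal.ofReal_mul (Real.exp_pos _).le, ← Real.exp_add, ← add_div,
        add_neg_cancel, zero_div, Real.exp_zero, ENNReal.ofReal_one]
    simp_rw [this]
    simp
  have hpd := two_mul_lintegral_mul_gop_le hε (β : Measure (Euc d)) (α : Measure (Euc d))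
    (φ := fun y => ENNReal.ofReal (Real.exp (h' y / ε)))
    (ψ := fun y => ENNReal.ofReal (Real.exp (h y / ε))) (by fun_prop) (by fun_prop)
  rw [hself hP.left, hself hP'.left, one_add_one_eq_two] at hpd
  have hcross : ∫⁻ x, ENNReal.ofReal (Real.exp ((h' x - h x) / ε)) ∂(β : Measure (Euc d)) ≤ 1 := by
    have e : ∀ x, ENNReal.ofReal (Real.exp ((h' x - h x) / ε)) =
        ENNReal.ofReal (Real.exp (h' x / ε)) * gop ε (α : Measure (Euc d))
        (fun y => ENNReal.ofReal (Real.exp (h y / ε))) x := fun x => by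
      rw [hP.left x, ← ENNReal.ofReal_mul (Real.exp_pos _).le, ← Real.exp_add, ← add_div,
        sub_eq_add_neg]
    simp_rw [e]
    by_contra hcon
    push Not at hcon
    refine absurd hpd (not_le.2 ?_)
    calc (2 : ℝ≥0∞) = 2 * 1 := (mul_one _).symm
      _ < _ := ENNReal.mul_lt_mul_right (by simp) (by simp) hcon
  have i' := hP'.integrable_left hβ
  have i := hP.integrable_left hβ
  have hsub : Integrable (fun x => (h' x - h x) / ε) (β : Measure (Euc d)) :=
    (i'.sub i).div_const ε
  have hexp : Integrable (fun x => Real.exp ((h' x - h x) / ε)) (β : Measure (Euc d)) := by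
    refine ⟨(by fun_prop : Measurable _).aestronglyMeasurable, ?_⟩
    rw [hasFiniteIntegral_iff_ofReal (Eventually.of_forall fun x => (Real.exp_pos _).le)]
    exact hcross.trans_lt ENNReal.one_lt_top
  have hle1 : ∫ x, Real.exp ((h' x - h x) / ε) ∂(β : Measure (Euc d)) ≤ 1 := by
    rw [integral_eq_lintegral_of_nonneg_ae (Eventually.of_forall fun x => (Real.exp_pos _).le)
      hexp.aestronglyMeasurable]
    exact ENNReal.toReal_le_of_le_ofReal zero_le_one (by simpa using hcross)
  have h1 : ∫ x, (h' x - h x) / ε + 1 ∂(β : Measure (Euc d)) ≤ 1 :=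
    (integral_mono (hsub.add (integrable_const 1)) hexp fun x => Real.add_one_le_exp _).trans hle1
  rw [integral_add hsub (integrable_const 1), integral_div, integral_sub i' i] at h1
  simp only [integral_const, probReal_univ, smul_eq_mul, mul_one] at h1
  have h2 : (∫ x, h' x ∂(β : Measure (Euc d)) - ∫ x, h x ∂(β : Measure (Euc d))) / ε ≤ 0 := by
    linarith
  rw [div_le_iff₀ hε, zero_mul] at h2
  linarith

/-! ### Upper bounds by mixtures of couplings -/

/-- The densities of the two summands of a finite measure `μ + ν` with respect to the sum. -/
lemma exists_mixture_weight (μ ν : Measure (Euc d)) [IsFiniteMeasure μ] [IsFiniteMeasure ν] :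
    ∃ ω : Euc d → ℝ, Measurable ω ∧ (∀ y, 0 ≤ ω y) ∧ (∀ y, ω y ≤ 1) ∧
      ∀ φ : Euc d → ℝ≥0∞, Measurable φ →
        ∫⁻ y, ENNReal.ofReal (1 - ω y) * φ y ∂(μ + ν) = ∫⁻ y, φ y ∂μ ∧
        ∫⁻ y, ENNReal.ofReal (ω y) * φ y ∂(μ + ν) = ∫⁻ y, φ y ∂ν := by
  have : IsFiniteMeasure (μ + ν) := inferInstance
  have : μ.HaveLebesgueDecomposition (μ + ν) :=
    Measure.haveLebesgueDecomposition_of_sigmaFinite _ _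
  have : ν.HaveLebesgueDecomposition (μ + ν) :=
    Measure.haveLebesgueDecomposition_of_sigmaFinite _ _
  have hμ : μ ≪ μ + ν := Measure.absolutelyContinuous_of_le (Measure.le_add_right le_rfl)
  have hν : ν ≪ μ + ν := Measure.absolutelyContinuous_of_le (Measure.le_add_left le_rfl)
  have hm : Measurable (ν.rnDeriv (μ + ν)) := Measure.measurable_rnDeriv _ _
  have hsum : ∀ᵐ y ∂(μ + ν), μ.rnDeriv (μ + ν) y + ν.rnDeriv (μ + ν) y = 1 := by
    filter_upwards [Measure.rnDeriv_add μ ν (μ + ν), Measure.rnDeriv_self (μ + ν)] with y h1 h2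
    rw [← h2, h1, Pi.add_apply]
  have hω : ∀ᵐ y ∂(μ + ν), ENNReal.ofReal (min (ν.rnDeriv (μ + ν) y).toReal 1) =
      ν.rnDeriv (μ + ν) y ∧ ENNReal.ofReal (1 - min (ν.rnDeriv (μ + ν) y).toReal 1) =
      μ.rnDeriv (μ + ν) y := by
    filter_upwards [hsum] with y hy
    have hle : ν.rnDeriv (μ + ν) y ≤ 1 := hy ▸ le_add_self
    have hne : ν.rnDeriv (μ + ν) y ≠ ∞ := (hle.trans_lt ENNReal.one_lt_top).ne
    have h1 : (ν.rnDeriv (μ + ν) y).toReal ≤ 1 := by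
      simpa using ENNReal.toReal_mono ENNReal.one_ne_top hle
    rw [min_eq_left h1, ENNReal.ofReal_sub _ ENNReal.toReal_nonneg, ENNReal.ofReal_toReal hne,
      ENNReal.ofReal_one]
    exact ⟨rfl, ENNReal.sub_eq_of_eq_add hne hy.symm⟩
  refine ⟨fun y => min (ν.rnDeriv (μ + ν) y).toReal 1, by fun_prop,
    fun y => le_min ENNReal.toReal_nonneg zero_le_one, fun y => min_le_right _ _,
    fun φ hφ => ⟨?_, ?_⟩⟩
  · rw [← lintegral_rnDeriv_mul hμ hφ.aemeasurable]
    refine lintegral_congr_ae ?_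
    filter_upwards [hω] with y hy
    rw [hy.2]
  · rw [← lintegral_rnDeriv_mul hν hφ.aemeasurable]
    refine lintegral_congr_ae ?_
    filter_upwards [hω] with y hy
    rw [hy.1]

/-- Upper bound for the cost from `a` to a sum `μ₁ + μ₂`, by a coupling that disintegrates into the
conditional densities `P₁` on `μ₁` and `P₂` on `μ₂`. By convexity, the chi-square divergences of
the two pieces from the Gibbs density add up. -/
lemma OT_le_mixture (hε : 0 < ε) {a α β : Prob d} (ha : a ∈ subGaussian d)
    (hβ : β ∈ subGaussian d) {f g : Euc d → ℝ} (hP : Potentials ε a α f g)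
    {μ₁ μ₂ : Measure (Euc d)} [IsFiniteMeasure μ₁] [IsFiniteMeasure μ₂]
    (hsum : (β : Measure (Euc d)) = μ₁ + μ₂)
    {P₁ P₂ : Euc d × Euc d → ℝ} (hm₁ : Measurable P₁) (hm₂ : Measurable P₂)
    (hP₁ : ∀ p, 0 ≤ P₁ p) (hP₂ : ∀ p, 0 ≤ P₂ p)
    (hy₁ : ∀ y, ∫⁻ x, ENNReal.ofReal (P₁ (x, y)) ∂(a : Measure (Euc d)) = 1)
    (hy₂ : ∀ y, ∫⁻ x, ENNReal.ofReal (P₂ (x, y)) ∂(a : Measure (Euc d)) = 1)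
    (hx : ∀ x, ∫⁻ y, ENNReal.ofReal (P₁ (x, y)) ∂μ₁ + ∫⁻ y, ENNReal.ofReal (P₂ (x, y)) ∂μ₂ = 1)
    {D₁ D₂ : ℝ} (hD₁ : 0 ≤ D₁) (hD₂ : 0 ≤ D₂)
    (h₁ : ∀ᵐ y ∂μ₁, ∫⁻ x, ENNReal.ofReal
      ((P₁ (x, y) - gibbs ε f g (x, y)) ^ 2 / gibbs ε f g (x, y)) ∂(a : Measure (Euc d)) ≤
        ENNReal.ofReal D₁)
    (h₂ : ∀ᵐ y ∂μ₂, ∫⁻ x, ENNReal.ofReal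
      ((P₂ (x, y) - gibbs ε f g (x, y)) ^ 2 / gibbs ε f g (x, y)) ∂(a : Measure (Euc d)) ≤
        ENNReal.ofReal D₂) :
    OT ε a β ≤ ∫ x, f x ∂(a : Measure (Euc d)) + ∫ y, g y ∂(β : Measure (Euc d)) +
      ε * (D₁ * μ₁.real univ + D₂ * μ₂.real univ) := by
  obtain ⟨ω, hωm, hω0, hω1, hω⟩ := exists_mixture_weight μ₁ μ₂
  rw [← hsum] at hω
  have hgm : Measurable (gibbs ε f g) := measurable_gibbs hP.meas_left hP.meas_right
  set ρ : Euc d × Euc d → ℝ := fun p => (1 - ω p.2) * P₁ p + ω p.2 * P₂ p with hρdef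
  have hρm : Measurable ρ := by fun_prop
  have hω1' : ∀ y, 0 ≤ 1 - ω y := fun y => sub_nonneg.2 (hω1 y)
  have hρ0 : ∀ p, 0 ≤ ρ p := fun p =>
    add_nonneg (mul_nonneg (hω1' _) (hP₁ p)) (mul_nonneg (hω0 _) (hP₂ p))
  have hρof : ∀ p, ENNReal.ofReal (ρ p) = ENNReal.ofReal (1 - ω p.2) * ENNReal.ofReal (P₁ p) +
      ENNReal.ofReal (ω p.2) * ENNReal.ofReal (P₂ p) := fun p => by
    rw [hρdef, ENNReal.ofReal_add (mul_nonneg (hω1' _) (hP₁ p)) (mul_nonneg (hω0 _) (hP₂ p)),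
      ENNReal.ofReal_mul (hω1' _), ENNReal.ofReal_mul (hω0 _)]
  obtain ⟨hgi, hg1⟩ := hP.integral_gibbs β
  set χ : (Euc d × Euc d → ℝ) → Euc d × Euc d → ℝ :=
    fun P p => (P p - gibbs ε f g p) ^ 2 / gibbs ε f g p with hχdef
  have hχ0 : ∀ P p, 0 ≤ χ P p := fun P p => div_nonneg (sq_nonneg _) (gibbs_pos f g p).le
  have hχm : ∀ P, Measurable P → Measurable (χ P) := fun P hPm => by
    have := hPm.sub hgm
    simp only [hχdef]
    fun_prop
  have hχm₁ := hχm P₁ hm₁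
  have hχm₂ := hχm P₂ hm₂
  have hχmρ := hχm ρ hρm
  have hconv : ∀ p, ENNReal.ofReal (χ ρ p) ≤
      ENNReal.ofReal (1 - ω p.2) * ENNReal.ofReal (χ P₁ p) +
      ENNReal.ofReal (ω p.2) * ENNReal.ofReal (χ P₂ p) := fun p => by
    rw [← ENNReal.ofReal_mul (hω1' _), ← ENNReal.ofReal_mul (hω0 _),
      ← ENNReal.ofReal_add (mul_nonneg (hω1' _) (hχ0 _ _)) (mul_nonneg (hω0 _) (hχ0 _ _))]
    refine ENNReal.ofReal_le_ofReal ?_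
    simp only [hχdef, hρdef]
    rw [← mul_div_assoc, ← mul_div_assoc, ← add_div]
    refine div_le_div_of_nonneg_right ?_ (gibbs_pos f g p).le
    nlinarith [mul_nonneg (mul_nonneg (hω0 p.2) (hω1' p.2)) (sq_nonneg (P₁ p - P₂ p))]
  have hχint : ∫⁻ p, ENNReal.ofReal (χ ρ p) ∂(a : Measure (Euc d)).prod (β : Measure (Euc d)) ≤
      ENNReal.ofReal (D₁ * μ₁.real univ + D₂ * μ₂.real univ) := by
    calc ∫⁻ p, ENNReal.ofReal (χ ρ p) ∂(a : Measure (Euc d)).prod (β : Measure (Euc d))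
        ≤ ∫⁻ p, (ENNReal.ofReal (1 - ω p.2) * ENNReal.ofReal (χ P₁ p) +
            ENNReal.ofReal (ω p.2) * ENNReal.ofReal (χ P₂ p))
            ∂(a : Measure (Euc d)).prod (β : Measure (Euc d)) := lintegral_mono hconv
      _ = ∫⁻ y, (ENNReal.ofReal (1 - ω y) *
              ∫⁻ x, ENNReal.ofReal (χ P₁ (x, y)) ∂(a : Measure (Euc d)) +
            ENNReal.ofReal (ω y) * ∫⁻ x, ENNReal.ofReal (χ P₂ (x, y)) ∂(a : Measure (Euc d)))
            ∂(β : Measure (Euc d)) := by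
          rw [lintegral_prod_symm' _ (by fun_prop)]
          refine lintegral_congr fun y => ?_
          dsimp only
          rw [lintegral_add_left (by fun_prop), lintegral_const_mul _ (by fun_prop),
            lintegral_const_mul _ (by fun_prop)]
      _ = ∫⁻ y, ∫⁻ x, ENNReal.ofReal (χ P₁ (x, y)) ∂(a : Measure (Euc d)) ∂μ₁ +
            ∫⁻ y, ∫⁻ x, ENNReal.ofReal (χ P₂ (x, y)) ∂(a : Measure (Euc d)) ∂μ₂ := by
          have hi₁ : Measurable fun y =>
              ∫⁻ x, ENNReal.ofReal (χ P₁ (x, y)) ∂(a : Measure (Euc d)) :=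
            Measurable.lintegral_prod_left' (f := fun p => ENNReal.ofReal (χ P₁ p)) (by fun_prop)
          have hi₂ : Measurable fun y =>
              ∫⁻ x, ENNReal.ofReal (χ P₂ (x, y)) ∂(a : Measure (Euc d)) :=
            Measurable.lintegral_prod_left' (f := fun p => ENNReal.ofReal (χ P₂ p)) (by fun_prop)
          rw [lintegral_add_left (by fun_prop), (hω _ hi₁).1, (hω _ hi₂).2]
      _ ≤ ∫⁻ _, ENNReal.ofReal D₁ ∂μ₁ + ∫⁻ _, ENNReal.ofReal D₂ ∂μ₂ :=
          add_le_add (lintegral_mono_ae h₁) (lintegral_mono_ae h₂)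
      _ = _ := by
          rw [lintegral_const, lintegral_const, ENNReal.ofReal_add (by positivity) (by positivity),
            ENNReal.ofReal_mul hD₁, ENNReal.ofReal_mul hD₂, ofReal_measureReal, ofReal_measureReal]
  have hχρ : Integrable (χ ρ) ((a : Measure (Euc d)).prod (β : Measure (Euc d))) := by
    refine ⟨hχmρ.aestronglyMeasurable, ?_⟩
    rw [hasFiniteIntegral_iff_ofReal (Eventually.of_forall (hχ0 ρ))]
    exact hχint.trans_lt ENNReal.ofReal_lt_top
  have hχle : ∫ p, χ ρ p ∂(a : Measure (Euc d)).prod (β : Measure (Euc d)) ≤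
      D₁ * μ₁.real univ + D₂ * μ₂.real univ := by
    rw [integral_eq_lintegral_of_nonneg_ae (Eventually.of_forall (hχ0 ρ))
      hχmρ.aestronglyMeasurable]
    exact ENNReal.toReal_le_of_le_ofReal (by positivity) hχint
  refine (entropicCost_le_chiSq hε (hP.integrable_left ha) (hP.integrable_right hβ) hgi hg1 hρm hρ0
    (Eventually.of_forall fun x => ?_) (Eventually.of_forall fun y => ?_) hχρ).2.trans ?_
  · simp_rw [hρof]
    rw [lintegral_add_left (by fun_prop), (hω _ (by fun_prop)).1, (hω _ (by fun_prop)).2, hx]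
  · simp_rw [hρof]
    rw [lintegral_add_left (by fun_prop), lintegral_const_mul _ (by fun_prop),
      lintegral_const_mul _ (by fun_prop), hy₁, hy₂, mul_one, mul_one,
      ← ENNReal.ofReal_add (hω1' y) (hω0 y)]
    simp
  · gcongr

/-! ### Perturbation of a measure towards a point -/

/-- The measure `α` after removal of the mass `t` from the set `B`, in proportion to `α`. -/
def damp (α : Measure (Euc d)) (B : Set (Euc d)) (t : ℝ) : Measure (Euc d) :=
  α.restrict Bᶜ + ENNReal.ofReal (1 - t / α.real B) • α.restrict B

/-- The measure `α + t (δ_y - α(· ∣ B))`, obtained from `α` by moving the mass `t` from the set `B`,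
in proportion to `α`, to the point `y`. -/
def perturb (α : Measure (Euc d)) (B : Set (Euc d)) (y : Euc d) (t : ℝ) : Measure (Euc d) :=
  damp α B t + ENNReal.ofReal t • Measure.dirac y

lemma damp_le (α : Measure (Euc d)) {B : Set (Euc d)} (hB : MeasurableSet B) {t : ℝ}
    (ht : 0 ≤ t) : damp α B t ≤ α := by
  have h1 : ENNReal.ofReal (1 - t / α.real B) ≤ 1 := by
    rw [ENNReal.ofReal_le_one]
    have : 0 ≤ t / α.real B := by positivity
    linarith
  calc damp α B t ≤ α.restrict Bᶜ + (1 : ℝ≥0∞) • α.restrict B := by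
        unfold damp; gcongr
    _ = α := by rw [one_smul, add_comm, Measure.restrict_add_restrict_compl hB]

instance (α : Measure (Euc d)) [IsFiniteMeasure α] (B : Set (Euc d)) (t : ℝ) :
    IsFiniteMeasure (damp α B t) := by
  unfold damp
  have : IsFiniteMeasure (ENNReal.ofReal (1 - t / α.real B) • α.restrict B) :=
    Measure.smul_finite _ ENNReal.ofReal_ne_top
  infer_instance

instance (t : ℝ) (y : Euc d) : IsFiniteMeasure (ENNReal.ofReal t • Measure.dirac y) :=
  Measure.smul_finite _ ENNReal.ofReal_ne_top

lemma integrable_perturb {α : Measure (Euc d)} {B : Set (Euc d)} (hB : MeasurableSet B)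
    {y : Euc d} {t : ℝ} (ht : 0 ≤ t) {φ : Euc d → ℝ} (hφ : Integrable φ α) :
    Integrable φ (perturb α B y t) := by
  refine (hφ.mono_measure (damp_le α hB ht)).add_measure ?_
  exact (integrable_dirac (by simp)).smul_measure ENNReal.ofReal_ne_top

lemma integral_perturb {α : Measure (Euc d)} {B : Set (Euc d)} (hB : MeasurableSet B)
    {y : Euc d} {t : ℝ} (ht : 0 ≤ t) (htB : t ≤ α.real B) {φ : Euc d → ℝ}
    (hφ : Integrable φ α) :
    ∫ x, φ x ∂(perturb α B y t) =
      ∫ x, φ x ∂α - t * ((α.real B)⁻¹ * ∫ x in B, φ x ∂α) + t * φ y := by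
  have i1 : Integrable φ (α.restrict Bᶜ) := hφ.restrict
  have i2 : Integrable φ (ENNReal.ofReal (1 - t / α.real B) • α.restrict B) :=
    hφ.restrict.smul_measure ENNReal.ofReal_ne_top
  have i3 : Integrable φ (ENNReal.ofReal t • Measure.dirac y) :=
    (integrable_dirac (by simp)).smul_measure ENNReal.ofReal_ne_top
  have hle : t / α.real B ≤ 1 := div_le_one_of_le₀ htB measureReal_nonneg
  have hsplit := integral_add_compl hB hφ
  rw [perturb, damp, integral_add_measure (i1.add_measure i2) i3,
    integral_add_measure i1 i2, integral_smul_measure, integral_smul_measure, integral_dirac,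
    ENNReal.toReal_ofReal ht, ENNReal.toReal_ofReal (by linarith), ← hsplit]
  simp only [smul_eq_mul]
  ring

lemma lintegral_damp (α : Measure (Euc d)) (B : Set (Euc d)) (t : ℝ) (φ : Euc d → ℝ≥0∞) :
    ∫⁻ x, φ x ∂(damp α B t) =
      ∫⁻ x in Bᶜ, φ x ∂α + ENNReal.ofReal (1 - t / α.real B) * ∫⁻ x in B, φ x ∂α := by
  rw [damp, lintegral_add_measure, lintegral_smul_measure, smul_eq_mul]

lemma isProbabilityMeasure_perturb {α : Measure (Euc d)} [IsProbabilityMeasure α]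
    {B : Set (Euc d)} (hB : MeasurableSet B) {y : Euc d} {t : ℝ} (ht : 0 ≤ t)
    (htB : t ≤ α.real B) (hpos : 0 < α.real B) : IsProbabilityMeasure (perturb α B y t) := by
  have hfin : IsFiniteMeasure (perturb α B y t) := by
    unfold perturb; infer_instance
  have h := integral_perturb (y := y) hB ht htB (integrable_const (μ := α) (1 : ℝ))
  simp only [integral_const, smul_eq_mul, mul_one, probReal_univ, measureReal_restrict_apply_univ,
    inv_mul_cancel₀ hpos.ne', sub_add_cancel] at h
  constructor
  rw [← ENNReal.toReal_eq_one_iff]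
  exact h

lemma perturb_mem_subGaussian {α β : Prob d} (hα : α ∈ subGaussian d) {B : Set (Euc d)}
    (hB : MeasurableSet B) {y : Euc d} {t : ℝ} (ht : 0 ≤ t)
    (hβ : (β : Measure (Euc d)) = perturb (α : Measure (Euc d)) B y t) : β ∈ subGaussian d := by
  obtain ⟨q, hq, hint⟩ := hα
  refine ⟨q, hq, ?_⟩
  rw [hβ]
  exact integrable_perturb hB ht hint

/-! ### Directional derivatives of the transport costs -/

lemma Potentials.integrable_gibbs_left {α β : Prob d} {f g : Euc d → ℝ}
    (h : Potentials ε α β f g) (y : Euc d) :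
    Integrable (fun x => gibbs ε f g (x, y)) (α : Measure (Euc d)) ∧
    ∫ x, gibbs ε f g (x, y) ∂(α : Measure (Euc d)) = 1 := by
  have hm : Measurable (gibbs ε f g) := measurable_gibbs h.meas_left h.meas_right
  have hm' : Measurable fun x => gibbs ε f g (x, y) := by fun_prop
  have hpos : 0 ≤ᵐ[(α : Measure (Euc d))] fun x => gibbs ε f g (x, y) :=
    Eventually.of_forall fun x => (gibbs_pos f g _).le
  refine ⟨⟨hm'.aestronglyMeasurable, ?_⟩, ?_⟩
  · rw [hasFiniteIntegral_iff_ofReal hpos, h.lintegral_gibbs_left]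
    exact ENNReal.one_lt_top
  · rw [integral_eq_lintegral_of_nonneg_ae hpos hm'.aestronglyMeasurable, h.lintegral_gibbs_left]
    simp

lemma Potentials.integrable_gibbs_right {α β : Prob d} {f g : Euc d → ℝ}
    (h : Potentials ε α β f g) (x : Euc d) :
    Integrable (fun y => gibbs ε f g (x, y)) (β : Measure (Euc d)) ∧
    ∫ y, gibbs ε f g (x, y) ∂(β : Measure (Euc d)) = 1 := by
  simp_rw [gibbs_swap f g]
  exact h.symm.integrable_gibbs_left x

lemma tendsto_setIntegral_closedBall {μ : Measure (Euc d)} {φ : Euc d → ℝ}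
    (hφ : Integrable φ μ) :
    Tendsto (fun n : ℕ => ∫ x in Metric.closedBall 0 n, φ x ∂μ) atTop (𝓝 (∫ x, φ x ∂μ)) := by
  have := tendsto_setIntegral_of_monotone (μ := μ) (f := φ)
    (s := fun n : ℕ => Metric.closedBall (0 : Euc d) n)
    (fun n => Metric.isClosed_closedBall.measurableSet)
    (fun m n hmn => Metric.closedBall_subset_closedBall (by exact_mod_cast hmn))
    hφ.integrableOn
  rwa [Metric.iUnion_closedBall_nat, Measure.restrict_univ] at this

/-- The conditional density of the first coordinate given the new point `y₀`: the Gibbs density,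
truncated to a ball and normalized. The truncation makes it comparable with the Gibbs density
at every other point of a bounded set, and its chi-square distance from the Gibbs density at `y₀` is
as small as wished. -/
lemma Potentials.exists_truncated_density {a α : Prob d} {f g : Euc d → ℝ}
    (hε : 0 < ε) (hP : Potentials ε a α f g) (y₀ : Euc d) (R : ℝ) {δ : ℝ} (hδ : 0 < δ) :
    ∃ (n : Euc d → ℝ) (Q : ℝ), Measurable n ∧ (∀ x, 0 ≤ n x) ∧ 1 ≤ Q ∧
      Integrable n (a : Measure (Euc d)) ∧ ∫ x, n x ∂(a : Measure (Euc d)) = 1 ∧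
      (∀ x, n x ≤ Q) ∧ (∀ x y, ‖y‖ ≤ R → n x ≤ Q * gibbs ε f g (x, y)) ∧
      Integrable (fun x => (n x - gibbs ε f g (x, y₀)) ^ 2 / gibbs ε f g (x, y₀))
        (a : Measure (Euc d)) ∧
      ∫ x, (n x - gibbs ε f g (x, y₀)) ^ 2 / gibbs ε f g (x, y₀) ∂(a : Measure (Euc d)) ≤ δ := by
  have hgm : Measurable (gibbs ε f g) := measurable_gibbs hP.meas_left hP.meas_right
  set r : Euc d → ℝ := fun x => gibbs ε f g (x, y₀) with hr
  have hrm : Measurable r := by fun_prop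
  have hr0 : ∀ x, 0 < r x := fun x => gibbs_pos _ _ _
  obtain ⟨hri, hr1⟩ := hP.integrable_gibbs_left y₀
  have hlim := tendsto_setIntegral_closedBall hri
  rw [hr1] at hlim
  obtain ⟨S, hS⟩ := (hlim.eventually_const_lt
    (inv_lt_one_of_one_lt₀ (by linarith : 1 < 1 + δ))).exists
  set B := Metric.closedBall (0 : Euc d) S
  have hB : MeasurableSet B := Metric.isClosed_closedBall.measurableSet
  set Z := ∫ x in B, r x ∂(a : Measure (Euc d))
  have hZ : 0 < Z := lt_trans (by positivity) hS
  have hZδ : Z⁻¹ - 1 ≤ δ := by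
    have := inv_anti₀ (by positivity) hS.le
    rw [inv_inv] at this
    linarith
  set n : Euc d → ℝ := fun x => B.indicator r x / Z with hn
  have hnm : Measurable n := (hrm.indicator hB).div_const Z
  have hn0 : ∀ x, 0 ≤ n x := fun x =>
    div_nonneg (indicator_nonneg (fun x _ => (hr0 x).le) x) hZ.le
  have hni : Integrable n (a : Measure (Euc d)) := (hri.indicator hB).div_const Z
  have hn1 : ∫ x, n x ∂(a : Measure (Euc d)) = 1 := by
    simp only [hn]
    rw [integral_div, integral_indicator hB, div_self hZ.ne']
  obtain ⟨Mf, hMf⟩ := hP.growth_left.exists_bound S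
  obtain ⟨Mg, hMg⟩ := hP.growth_right.exists_bound R
  set q₁ := Real.exp ((Mf + g y₀) / ε) / Z
  set q₂ := Real.exp ((g y₀ + Mg + (S + R) ^ 2) / ε) / Z
  have hq₁ : ∀ x, n x ≤ q₁ := fun x => by
    refine div_le_div_of_nonneg_right ?_ hZ.le
    by_cases hx : x ∈ B
    · rw [indicator_of_mem hx]
      refine Real.exp_le_exp.2 (div_le_div_of_nonneg_right ?_ hε.le)
      have h1 := (abs_le.1 (hMf x (by simpa [B] using hx))).2
      have h2 : 0 ≤ cost x y₀ := sq_nonneg _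
      simp only; linarith
    · rw [indicator_of_notMem hx]
      exact (Real.exp_pos _).le
  have hq₂ : ∀ x y, ‖y‖ ≤ R → n x ≤ q₂ * gibbs ε f g (x, y) := fun x y hy => by
    rw [div_mul_eq_mul_div]
    refine div_le_div_of_nonneg_right ?_ hZ.le
    by_cases hx : x ∈ B
    · rw [indicator_of_mem hx]
      simp only [hr, gibbs]
      rw [← Real.exp_add, ← add_div]
      refine Real.exp_le_exp.2 (div_le_div_of_nonneg_right ?_ hε.le)
      have h1 := (abs_le.1 (hMg y hy)).1
      have h2 : 0 ≤ cost x y₀ := sq_nonneg _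
      have h3 : ‖x‖ ≤ S := by simpa [B] using hx
      have h4 := neg_cost_le_of_norm_le x hy
      have h5 : (‖x‖ + R) ^ 2 ≤ (S + R) ^ 2 := by
        have : 0 ≤ R := (norm_nonneg y).trans hy
        gcongr
      linarith
    · rw [indicator_of_notMem hx]
      have := gibbs_pos (ε := ε) f g (x, y)
      positivity
  -- the divergence integrates explicitly, as `n² / r = n / Z`
  have hχ : ∀ x, (n x - r x) ^ 2 / r x = Z⁻¹ * n x - 2 * n x + r x := fun x => by
    have := (hr0 x).ne'
    by_cases hx : x ∈ B
    · simp only [hn, indicator_of_mem hx]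
      field_simp
      ring
    · simp only [hn, indicator_of_notMem hx]
      field_simp
      ring
  have hni' : Integrable (fun x => Z⁻¹ * n x - 2 * n x) (a : Measure (Euc d)) :=
    (hni.const_mul _).sub (hni.const_mul _)
  have hχi : Integrable (fun x => Z⁻¹ * n x - 2 * n x + r x) (a : Measure (Euc d)) :=
    hni'.add hri
  refine ⟨n, max 1 (max q₁ q₂), hnm, hn0, le_max_left _ _, hni, hn1,
    fun x => (hq₁ x).trans ((le_max_left _ _).trans (le_max_right _ _)), fun x y hy => ?_, ?_, ?_⟩
  · refine (hq₂ x y hy).trans (mul_le_mul_of_nonneg_right ?_ (gibbs_pos _ _ _).le)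
    exact (le_max_right _ _).trans (le_max_right _ _)
  · exact hχi.congr (Eventually.of_forall fun x => (hχ x).symm)
  · have : ∫ x, (n x - r x) ^ 2 / r x ∂(a : Measure (Euc d)) = Z⁻¹ - 1 := by
      simp_rw [hχ]
      rw [integral_add hni' hri,
        integral_sub (hni.const_mul _) (hni.const_mul _), integral_const_mul, integral_const_mul,
        hn1, hr1]
      ring
    exact this.le.trans hZδ

/-- The right derivative of `OT_ε(a, ·)` at `α` along `perturb` is at most the one that the
potential `g` predicts. The competitor starts from the optimal coupling, in which mass over the ball
is rerouted to `y₀` with a fixed first marginal; its divergence from the Gibbs density is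
quadratic in `t` over the ball and small compared with `t` over `y₀`. -/
lemma Potentials.exists_OT_perturb_le (hε : 0 < ε) {a α : Prob d} (ha : a ∈ subGaussian d)
    (hα : α ∈ subGaussian d) {f g : Euc d → ℝ} (hP : Potentials ε a α f g) {R : ℝ}
    (hb : 0 < (α : Measure (Euc d)).real (Metric.closedBall 0 R)) (y₀ : Euc d) {η : ℝ}
    (hη : 0 < η) :
    ∃ t₀ > 0, ∀ t, 0 < t → t ≤ t₀ → ∀ β : Prob d,
      (β : Measure (Euc d)) = perturb (α : Measure (Euc d)) (Metric.closedBall 0 R) y₀ t →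
      OT ε a β ≤ OT ε a α + t * (g y₀ - ((α : Measure (Euc d)).real (Metric.closedBall 0 R))⁻¹ *
        ∫ x in Metric.closedBall 0 R, g x ∂(α : Measure (Euc d)) + η) := by
  obtain ⟨n, Q, hnm, hn0, hQ, hni, hn1, hnQ, hnQg, hχi, hχδ⟩ :=
    hP.exists_truncated_density hε y₀ R (δ := η / (2 * ε)) (by positivity)
  set B := Metric.closedBall (0 : Euc d) R with hBdef
  have hB : MeasurableSet B := Metric.isClosed_closedBall.measurableSet
  set b := (α : Measure (Euc d)).real B
  set M := b⁻¹
  have hM : 0 < M := inv_pos.2 hb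
  have hgm : Measurable (gibbs ε f g) := measurable_gibbs hP.meas_left hP.meas_right
  refine ⟨min (1 / (2 * M * Q)) (η / (8 * ε * M ^ 2 * (1 + Q ^ 2))),
    lt_min (by positivity) (by positivity), fun t ht htle β hβ => ?_⟩
  have ht1 : t * (2 * M * Q) ≤ 1 := by
    have := htle.trans (min_le_left _ _)
    rwa [le_div_iff₀ (by positivity)] at this
  have ht2 : t * (8 * ε * M ^ 2 * (1 + Q ^ 2)) ≤ η := by
    have := htle.trans (min_le_right _ _)
    rwa [le_div_iff₀ (by positivity)] at this
  have htM : 0 < t * M := by positivity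
  have htMQ : t * M * Q ≤ 1 / 2 := by linarith
  have htM1 : t * M ≤ 1 / 2 := by nlinarith
  have htb : t / b = t * M := div_eq_mul_inv t b
  have htleb : t ≤ b := by
    have : t / b ≤ 1 := by rw [htb]; linarith
    rwa [div_le_one hb] at this
  have h1M : 0 < 1 - t * M := by linarith
  classical
  -- the conditional density over the ball
  set P₁ : Euc d × Euc d → ℝ := (Prod.snd ⁻¹' B).piecewise
    (fun p => (gibbs ε f g p - t * M * n p.1) / (1 - t * M)) (gibbs ε f g)
  have hBs : MeasurableSet (Prod.snd ⁻¹' B : Set (Euc d × Euc d)) := measurable_snd hB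
  have hP₁m : Measurable P₁ := Measurable.piecewise hBs (by fun_prop) hgm
  have hP₁in : ∀ x y, y ∈ B → P₁ (x, y) = (gibbs ε f g (x, y) - t * M * n x) / (1 - t * M) :=
    fun x y hy => piecewise_eq_of_mem _ _ _ (show (x, y) ∈ Prod.snd ⁻¹' B from hy)
  have hP₁out : ∀ x y, y ∉ B → P₁ (x, y) = gibbs ε f g (x, y) :=
    fun x y hy => piecewise_eq_of_notMem _ _ _ (show (x, y) ∉ Prod.snd ⁻¹' B from hy)
  have hnum : ∀ x y, y ∈ B → 0 ≤ gibbs ε f g (x, y) - t * M * n x := fun x y hy => by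
    have h1 := hnQg x y (by simpa [hBdef] using hy)
    have h2 := mul_le_mul_of_nonneg_left h1 htM.le
    have h3 := gibbs_pos (ε := ε) f g (x, y)
    nlinarith
  have hP₁0 : ∀ p, 0 ≤ P₁ p := fun ⟨x, y⟩ => by
    by_cases hy : y ∈ B
    · rw [hP₁in x y hy]; exact div_nonneg (hnum x y hy) h1M.le
    · rw [hP₁out x y hy]; exact (gibbs_pos _ _ _).le
  have hnl : ∫⁻ x, ENNReal.ofReal (n x) ∂(a : Measure (Euc d)) = 1 := by
    rw [← ofReal_integral_eq_lintegral_ofReal hni (Eventually.of_forall hn0), hn1,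
      ENNReal.ofReal_one]
  have hy₁ : ∀ y, ∫⁻ x, ENNReal.ofReal (P₁ (x, y)) ∂(a : Measure (Euc d)) = 1 := fun y => by
    by_cases hy : y ∈ B
    · obtain ⟨hi, h1⟩ := hP.integrable_gibbs_left y
      have hi' : Integrable (fun x => (gibbs ε f g (x, y) - t * M * n x) / (1 - t * M))
          (a : Measure (Euc d)) := (hi.sub (hni.const_mul _)).div_const _
      simp_rw [fun x => hP₁in x y hy]
      rw [← ofReal_integral_eq_lintegral_ofReal hi'
        (Eventually.of_forall fun x => div_nonneg (hnum x y hy) h1M.le), integral_div,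
        integral_sub hi (hni.const_mul _), integral_const_mul, h1, hn1, mul_one,
        div_self h1M.ne', ENNReal.ofReal_one]
    · simp_rw [fun x => hP₁out x y hy]
      exact hP.lintegral_gibbs_left y
  have hx : ∀ x, ∫⁻ y, ENNReal.ofReal (P₁ (x, y)) ∂(damp (α : Measure (Euc d)) B t) +
      ∫⁻ _, ENNReal.ofReal (n x) ∂(ENNReal.ofReal t • Measure.dirac y₀) = 1 := fun x => by
    obtain ⟨hi, h1⟩ := hP.integrable_gibbs_right x
    have hi' : Integrable (fun y => (gibbs ε f g (x, y) - t * M * n x) / (1 - t * M))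
        ((α : Measure (Euc d)).restrict B) :=
      (hi.integrableOn.sub (integrable_const _)).div_const _
    have hin : ∫⁻ y in B, ENNReal.ofReal (P₁ (x, y)) ∂(α : Measure (Euc d)) =
        ENNReal.ofReal ((∫ y in B, gibbs ε f g (x, y) ∂(α : Measure (Euc d)) - t * n x) /
          (1 - t * M)) := by
      rw [setLIntegral_congr_fun hB fun y hy => by rw [hP₁in x y hy],
        ← ofReal_integral_eq_lintegral_ofReal hi'
          ((ae_restrict_iff' hB).2 (Eventually.of_forall fun y hy =>
            div_nonneg (hnum x y hy) h1M.le)),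
        integral_div, integral_sub hi.integrableOn (integrable_const _)]
      simp only [integral_const, measureReal_restrict_apply_univ, smul_eq_mul]
      congr 3
      change b * (t * b⁻¹ * n x) = t * n x
      field_simp
    have hin0 : 0 ≤ ∫ y in B, gibbs ε f g (x, y) ∂(α : Measure (Euc d)) - t * n x := by
      have : 0 ≤ ∫ y in B, (gibbs ε f g (x, y) - t * M * n x) ∂(α : Measure (Euc d)) :=
        setIntegral_nonneg hB fun y hy => hnum x y hy
      rw [integral_sub hi.integrableOn (integrable_const _)] at this
      simp only [integral_const, measureReal_restrict_apply_univ, smul_eq_mul] at this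
      have e : b * (t * b⁻¹ * n x) = t * n x := by field_simp
      rwa [show (α : Measure (Euc d)).real B * (t * M * n x) = t * n x from e] at this
    have hout0 : 0 ≤ ∫ y in Bᶜ, gibbs ε f g (x, y) ∂(α : Measure (Euc d)) :=
      setIntegral_nonneg hB.compl fun y _ => (gibbs_pos _ _ _).le
    have hout : ∫⁻ y in Bᶜ, ENNReal.ofReal (P₁ (x, y)) ∂(α : Measure (Euc d)) =
        ENNReal.ofReal (∫ y in Bᶜ, gibbs ε f g (x, y) ∂(α : Measure (Euc d))) := by
      rw [setLIntegral_congr_fun hB.compl fun y hy => by rw [hP₁out x y hy],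
        ← ofReal_integral_eq_lintegral_ofReal hi.integrableOn
          (Eventually.of_forall fun y => (gibbs_pos _ _ _).le)]
    rw [lintegral_damp, hin, hout, lintegral_smul_measure, lintegral_const, measure_univ, mul_one,
      smul_eq_mul, show t / (α : Measure (Euc d)).real B = t * M from htb,
      ← ENNReal.ofReal_mul h1M.le, mul_div_cancel₀ _ h1M.ne', ← ENNReal.ofReal_mul ht.le,
      ← ENNReal.ofReal_add hout0 hin0,
      ← ENNReal.ofReal_add (add_nonneg hout0 hin0) (mul_nonneg ht.le (hn0 x))]
    have := integral_add_compl hB hi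
    rw [h1] at this
    rw [show ∀ u v w : ℝ, u + (v - w) + w = v + u from fun u v w => by ring, this,
      ENNReal.ofReal_one]
  set D₁ : ℝ := 4 * (t * M) ^ 2 * (1 + Q ^ 2)
  have hpt : ∀ x y, (P₁ (x, y) - gibbs ε f g (x, y)) ^ 2 / gibbs ε f g (x, y) ≤
      4 * (t * M) ^ 2 * (gibbs ε f g (x, y) + Q ^ 2) := fun x y => by
    have hgp := gibbs_pos (ε := ε) f g (x, y)
    by_cases hy : y ∈ B
    · have hle := hnQg x y (by simpa [hBdef] using hy)
      have e : P₁ (x, y) - gibbs ε f g (x, y) =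
          (t * M) / (1 - t * M) * (gibbs ε f g (x, y) - n x) := by
        rw [hP₁in x y hy]; field_simp; ring
      have h1 : (t * M) / (1 - t * M) ≤ 2 * (t * M) := by
        rw [div_le_iff₀ h1M]; nlinarith
      have h2 : ((t * M) / (1 - t * M)) ^ 2 ≤ 4 * (t * M) ^ 2 := by
        calc ((t * M) / (1 - t * M)) ^ 2 ≤ (2 * (t * M)) ^ 2 := by gcongr
          _ = _ := by ring
      have h3 : (gibbs ε f g (x, y) - n x) ^ 2 / gibbs ε f g (x, y) ≤
          gibbs ε f g (x, y) + Q ^ 2 := by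
        rw [div_le_iff₀ hgp]
        have h4 : n x * n x ≤ Q * (Q * gibbs ε f g (x, y)) :=
          mul_le_mul (hnQ x) hle (hn0 x) (by linarith)
        nlinarith [mul_nonneg hgp.le (hn0 x)]
      rw [e, mul_pow, mul_div_assoc]
      exact mul_le_mul h2 h3 (div_nonneg (sq_nonneg _) hgp.le) (by positivity)
    · rw [hP₁out x y hy, sub_self]
      have : 0 ≤ 4 * (t * M) ^ 2 * (gibbs ε f g (x, y) + Q ^ 2) := by positivity
      simpa using this
  have h₁ : ∀ y, ∫⁻ x, ENNReal.ofReal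
      ((P₁ (x, y) - gibbs ε f g (x, y)) ^ 2 / gibbs ε f g (x, y)) ∂(a : Measure (Euc d)) ≤
        ENNReal.ofReal D₁ := fun y => by
    obtain ⟨hi, h1⟩ := hP.integrable_gibbs_left y
    have hi' : Integrable (fun x => 4 * (t * M) ^ 2 * (gibbs ε f g (x, y) + Q ^ 2))
        (a : Measure (Euc d)) := (hi.add (integrable_const (Q ^ 2))).const_mul _
    refine (lintegral_mono fun x => ENNReal.ofReal_le_ofReal (hpt x y)).trans ?_
    rw [← ofReal_integral_eq_lintegral_ofReal hi' (Eventually.of_forall fun x => by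
      have := gibbs_pos (ε := ε) f g (x, y)
      positivity), integral_const_mul]
    have : ∫ x, gibbs ε f g (x, y) + Q ^ 2 ∂(a : Measure (Euc d)) = 1 + Q ^ 2 := by
      rw [integral_add hi (integrable_const _), h1]
      simp
    rw [this]
  have hβG := perturb_mem_subGaussian hα hB ht.le hβ
  have hle := OT_le_mixture hε ha hβG hP (μ₁ := damp (α : Measure (Euc d)) B t)
    (μ₂ := ENNReal.ofReal t • Measure.dirac y₀) hβ hP₁m (P₂ := fun p => n p.1)
    (by fun_prop) hP₁0 (fun p => hn0 _) hy₁ (fun _ => hnl) hx (D₁ := D₁) (D₂ := η / (2 * ε))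
    (by positivity) (by positivity) (Eventually.of_forall h₁) ?_
  swap
  · refine Measure.ae_smul_measure ?_ _
    rw [ae_dirac_eq]
    refine Filter.eventually_pure.2 ?_
    rw [← ofReal_integral_eq_lintegral_ofReal hχi
      (Eventually.of_forall fun x => div_nonneg (sq_nonneg _) (gibbs_pos _ _ _).le)]
    exact ENNReal.ofReal_le_ofReal hχδ
  have hmass1 : (damp (α : Measure (Euc d)) B t).real univ ≤ 1 := by
    have : damp (α : Measure (Euc d)) B t univ ≤ 1 :=
      ((damp_le (α : Measure (Euc d)) hB ht.le) univ).trans prob_le_one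
    exact ENNReal.toReal_le_of_le_ofReal zero_le_one (by rwa [ENNReal.ofReal_one])
  have hmass2 : (ENNReal.ofReal t • Measure.dirac y₀ : Measure (Euc d)).real univ = t := by
    simp [measureReal_def, ENNReal.toReal_ofReal ht.le]
  have hgint : ∫ y, g y ∂(β : Measure (Euc d)) = ∫ x, g x ∂(α : Measure (Euc d)) -
      t * (M * ∫ x in B, g x ∂(α : Measure (Euc d))) + t * g y₀ := by
    rw [hβ]
    exact integral_perturb hB ht.le htleb (hP.integrable_right hα)
  rw [hmass2, hgint] at hle
  rw [hP.OT_eq hε ha hα]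
  have hD : ε * (D₁ * (damp (α : Measure (Euc d)) B t).real univ + η / (2 * ε) * t) ≤ t * η := by
    have e1 : D₁ * (damp (α : Measure (Euc d)) B t).real univ ≤ D₁ :=
      mul_le_of_le_one_right (by positivity) hmass1
    have e2 : ε * D₁ ≤ t * η / 2 := by
      have := mul_le_mul_of_nonneg_left ht2 ht.le
      simp only [D₁]
      linarith
    have e3 : ε * (η / (2 * ε) * t) = t * η / 2 := by field_simp
    have e4 := mul_le_mul_of_nonneg_left e1 hε.le
    rw [mul_add, e3]
    linarith
  linarith

/-- `OT_ε(β, β) / 2` stays above the linear form given by the symmetric potential of `α`, up to a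
quadratic error along `perturb`: the Gibbs density of `α` has mass `1 + O(t²)` against `β ⊗ β`. -/
lemma Potentials.le_OT_self_perturb (hε : 0 < ε) {α : Prob d} (hα : α ∈ subGaussian d)
    {h : Euc d → ℝ} (hP : Potentials ε α α h h) {B : Set (Euc d)} (hB : MeasurableSet B)
    (hb : 0 < (α : Measure (Euc d)).real B) (y₀ : Euc d) {t : ℝ} (ht : 0 ≤ t)
    (htb : t ≤ (α : Measure (Euc d)).real B) {β : Prob d}
    (hβ : (β : Measure (Euc d)) = perturb (α : Measure (Euc d)) B y₀ t) :
    2 * ∫ x, h x ∂(β : Measure (Euc d)) -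
      ε * (t ^ 2 * (((α : Measure (Euc d)).real B)⁻¹ + gibbs ε h h (y₀, y₀))) ≤ OT ε β β := by
  set M := ((α : Measure (Euc d)).real B)⁻¹
  have hM : 0 < M := inv_pos.2 hb
  have hβG := perturb_mem_subGaussian hα hB ht hβ
  have hgm : Measurable (gibbs ε h h) := measurable_gibbs hP.meas_left hP.meas_left
  have hform : ∀ φ : Euc d → ℝ, Integrable φ (α : Measure (Euc d)) →
      Integrable φ (β : Measure (Euc d)) ∧ ∫ x, φ x ∂(β : Measure (Euc d)) =
        ∫ x, φ x ∂(α : Measure (Euc d)) - t * (M * ∫ x in B, φ x ∂(α : Measure (Euc d))) +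
          t * φ y₀ := fun φ hφ => by
    rw [hβ]
    exact ⟨integrable_perturb hB ht hφ, integral_perturb hB ht htb hφ⟩
  set k : Euc d → Euc d → ℝ := fun x z => gibbs ε h h (x, z)
  have hk0 : ∀ x z, 0 ≤ k x z := fun x z => (gibbs_pos _ _ _).le
  have hki : ∀ x, Integrable (k x) (α : Measure (Euc d)) := fun x => (hP.integrable_gibbs_right x).1
  have hk1 : ∀ x, ∫ z, k x z ∂(α : Measure (Euc d)) = 1 := fun x => (hP.integrable_gibbs_right x).2
  set A : Euc d → ℝ := fun x => M * ∫ z in B, k x z ∂(α : Measure (Euc d))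
  have hAm : Measurable A := by
    have : StronglyMeasurable fun x => ∫ z in B, k x z ∂(α : Measure (Euc d)) :=
      StronglyMeasurable.integral_prod_right' (f := gibbs ε h h) hgm.stronglyMeasurable
    exact this.measurable.const_mul M
  have hA0 : ∀ x, 0 ≤ A x := fun x =>
    mul_nonneg hM.le (setIntegral_nonneg hB fun z _ => hk0 x z)
  have hA1 : ∀ x, A x ≤ M := fun x => by
    refine mul_le_of_le_one_right hM.le ?_
    rw [← hk1 x]
    exact setIntegral_le_integral (hki x) (Eventually.of_forall (hk0 x))
  have hAi : Integrable A (α : Measure (Euc d)) :=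
    (integrable_const M).mono' hAm.aestronglyMeasurable (Eventually.of_forall fun x => by
      rw [Real.norm_eq_abs, abs_of_nonneg (hA0 x)]; exact hA1 x)
  have hAint : ∫ x, A x ∂(α : Measure (Euc d)) = 1 := by
    have hprod := (hP.integral_gibbs α).1
    have hprod' : Integrable (Function.uncurry k)
        ((α : Measure (Euc d)).prod ((α : Measure (Euc d)).restrict B)) := by
      have := hprod.mono_measure (Measure.prod_mono (le_refl (α : Measure (Euc d)))
        (Measure.restrict_le_self (μ := (α : Measure (Euc d))) (s := B)))
      exact this
    have hswap : ∀ z, ∫ x, k x z ∂(α : Measure (Euc d)) = 1 := fun z =>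
      (hP.integrable_gibbs_left z).2
    simp only [A]
    rw [integral_const_mul, integral_integral_swap hprod']
    simp_rw [hswap]
    simp only [integral_const, measureReal_restrict_apply_univ, smul_eq_mul, mul_one]
    exact inv_mul_cancel₀ hb.ne'
  -- the marginal mass of the Gibbs density against the perturbed measure
  have hQ : ∀ x, Integrable (k x) (β : Measure (Euc d)) ∧
      ∫ z, k x z ∂(β : Measure (Euc d)) = 1 - t * A x + t * k x y₀ := fun x => by
    have := hform (k x) (hki x)
    rwa [hk1] at this
  have hsymm : ∀ x z, k x z = k z x := fun x z => gibbs_swap h h x z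
  have hAβ := hform A hAi
  have hkβ : Integrable (fun x => k x y₀) (β : Measure (Euc d)) := by
    simp_rw [fun x => hsymm x y₀]
    exact (hQ y₀).1
  have hAi' : Integrable (fun x => 1 - t * A x) (β : Measure (Euc d)) :=
    (integrable_const 1).sub (hAβ.1.const_mul t)
  have hRi : Integrable (fun x => 1 - t * A x + t * k x y₀) (β : Measure (Euc d)) :=
    hAi'.add (hkβ.const_mul t)
  have hprodβ : Integrable (gibbs ε h h) ((β : Measure (Euc d)).prod (β : Measure (Euc d))) := by
    rw [integrable_prod_iff hgm.aestronglyMeasurable]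
    refine ⟨Eventually.of_forall fun x => (hQ x).1, ?_⟩
    refine hRi.congr (Eventually.of_forall fun x => ?_)
    dsimp only
    rw [← (hQ x).2]
    refine integral_congr_ae (Eventually.of_forall fun z => ?_)
    exact (Real.norm_of_nonneg (hk0 x z)).symm
  have hmass : ∫ p, gibbs ε h h p ∂(β : Measure (Euc d)).prod (β : Measure (Euc d)) ≤
      1 + t ^ 2 * (M + k y₀ y₀) := by
    have e1 : ∫ p, gibbs ε h h p ∂(β : Measure (Euc d)).prod (β : Measure (Euc d)) =
        1 - t * ∫ x, A x ∂(β : Measure (Euc d)) + t * ∫ x, k x y₀ ∂(β : Measure (Euc d)) := by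
      rw [integral_prod _ hprodβ, integral_congr_ae (Eventually.of_forall fun x => (hQ x).2),
        integral_add hAi' (hkβ.const_mul t),
        integral_sub (integrable_const 1) (hAβ.1.const_mul t), integral_const_mul t A,
        integral_const_mul t fun x => k x y₀]
      simp
    have e2 : ∫ x, k x y₀ ∂(β : Measure (Euc d)) ≤ 1 + t * k y₀ y₀ := by
      simp_rw [fun x => hsymm x y₀]
      rw [(hQ y₀).2]
      have := mul_nonneg ht (hA0 y₀)
      linarith
    have e3 : 1 - t * M ≤ ∫ x, A x ∂(β : Measure (Euc d)) := by
      rw [hAβ.2, hAint]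
      have h1 : ∫ x in B, A x ∂(α : Measure (Euc d)) ≤ 1 := by
        rw [← hAint]
        exact setIntegral_le_integral hAi (Eventually.of_forall hA0)
      have h2 : t * (M * ∫ x in B, A x ∂(α : Measure (Euc d))) ≤ t * M :=
        mul_le_mul_of_nonneg_left (mul_le_of_le_one_right hM.le h1) ht
      have := mul_nonneg ht (hA0 y₀)
      linarith
    have e4 := mul_le_mul_of_nonneg_left e2 ht
    have e5 := mul_le_mul_of_nonneg_left e3 ht
    rw [e1]
    linarith
  have hdual := dual_le_OT hε hβG hβG (hP.integrable_left hβG) (hP.integrable_left hβG) hprodβ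
  have := mul_le_mul_of_nonneg_left hmass hε.le
  linarith

/-! ### First-order optimality -/

/-- The functional `∑ k, w k * OT_ε(a k, ·) - (c / 2) OT_ε(·, ·)`: the entropic barycenter objective
for `c = 0` and, up to a constant, the Sinkhorn divergence objective for `c = 1`. -/
def objective {K : ℕ} (ε c : ℝ) (w : Fin K → ℝ) (a : Fin K → Prob d) (β : Prob d) : ℝ :=
  ∑ k, w k * OT ε (a k) β - c / 2 * OT ε β β

lemma integral_combination {K : ℕ} {g : Fin K → Euc d → ℝ} {h : Euc d → ℝ} {w : Fin K → ℝ}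
    {c : ℝ} {μ : Measure (Euc d)} (hg : ∀ k, Integrable (g k) μ) (hh : Integrable h μ) :
    ∫ x, (∑ k, w k * g k x) - c * h x ∂μ = (∑ k, w k * ∫ x, g k x ∂μ) - c * ∫ x, h x ∂μ := by
  rw [integral_sub (integrable_finsetSum _ fun k _ => (hg k).const_mul _) (hh.const_mul c),
    integral_finsetSum _ fun k _ => (hg k).const_mul _, integral_const_mul]
  simp_rw [integral_const_mul]

/-- Sufficiency: the potentials give a global tangent inequality for the objective. -/
lemma objective_le_of_pairing {K : ℕ} (hε : 0 < ε) {c : ℝ} (hc : 0 ≤ c) {w : Fin K → ℝ}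
    (hw : ∀ k, 0 ≤ w k) {a : Fin K → Prob d} (ha : ∀ k, a k ∈ subGaussian d) {α β : Prob d}
    (hα : α ∈ subGaussian d) (hβ : β ∈ subGaussian d) {f g : Fin K → Euc d → ℝ}
    {h : Euc d → ℝ} (hP : ∀ k, Potentials ε (a k) α (f k) (g k)) (hH : Potentials ε α α h h)
    (hpair : ∫ x, (∑ k, w k * g k x) - c * h x ∂(α : Measure (Euc d)) ≤
      ∫ x, (∑ k, w k * g k x) - c * h x ∂(β : Measure (Euc d))) :
    objective ε c w a α ≤ objective ε c w a β := by
  obtain ⟨h', hH'⟩ := exists_symmetric_potential hε hβ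
  rw [integral_combination (fun k => (hP k).integrable_right hα) (hH.integrable_left hα),
    integral_combination (fun k => (hP k).integrable_right hβ) (hH.integrable_left hβ)] at hpair
  have h1 : ∀ k, w k * OT ε (a k) α + (w k * ∫ x, g k x ∂(β : Measure (Euc d)) -
      w k * ∫ x, g k x ∂(α : Measure (Euc d))) ≤ w k * OT ε (a k) β := fun k => by
    have := mul_le_mul_of_nonneg_left ((hP k).le_OT hε (ha k) hβ) (hw k)
    rw [(hP k).OT_eq hε (ha k) hα]
    linarith
  have h2 := Finset.sum_le_sum fun k (_ : k ∈ Finset.univ) => h1 k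
  rw [Finset.sum_add_distrib, Finset.sum_sub_distrib] at h2
  have h3 := mul_le_mul_of_nonneg_left (hH.integral_symmetric_le hε hβ hH') hc
  rw [objective, objective, hH.OT_eq hε hα hα, hH'.OT_eq hε hβ hβ]
  linarith

/-- Necessity at a point: moving a small mass to `y` from a ball where it is taken in proportion to
`α` does not decrease the objective to first order; then the ball exhausts the space. -/
lemma integral_le_of_objective_le {K : ℕ} (hε : 0 < ε) {c : ℝ} (hc : 0 ≤ c) {w : Fin K → ℝ}
    (hw : ∀ k, 0 ≤ w k) (hw1 : ∑ k, w k = 1) {a : Fin K → Prob d}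
    (ha : ∀ k, a k ∈ subGaussian d) {α : Prob d}
    (hα : α ∈ subGaussian d) {f g : Fin K → Euc d → ℝ} {h : Euc d → ℝ}
    (hP : ∀ k, Potentials ε (a k) α (f k) (g k)) (hH : Potentials ε α α h h)
    (hmin : ∀ β ∈ subGaussian d, objective ε c w a α ≤ objective ε c w a β) (y : Euc d) :
    ∫ x, (∑ k, w k * g k x) - c * h x ∂(α : Measure (Euc d)) ≤ (∑ k, w k * g k y) - c * h y := by
  set u : Euc d → ℝ := fun x => (∑ k, w k * g k x) - c * h x with hu
  have hgi := fun k => (hP k).integrable_right hα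
  have hhi := hH.integrable_left hα
  have hui : Integrable u (α : Measure (Euc d)) :=
    (integrable_finsetSum _ fun k _ => (hgi k).const_mul _).sub (hhi.const_mul c)
  have hball : ∀ n : ℕ, ∫ x in Metric.closedBall 0 n, u x ∂(α : Measure (Euc d)) ≤
      (α : Measure (Euc d)).real (Metric.closedBall 0 n) * u y := by
    intro n
    set B := Metric.closedBall (0 : Euc d) n
    have hB : MeasurableSet B := Metric.isClosed_closedBall.measurableSet
    rcases (measureReal_nonneg (μ := (α : Measure (Euc d))) (s := B)).eq_or_lt with hb | hb
    · have : (α : Measure (Euc d)).restrict B = 0 := by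
        rw [Measure.restrict_eq_zero]
        exact (measureReal_eq_zero_iff).1 hb.symm
      rw [this, ← hb]
      simp
    rw [← inv_mul_le_iff₀ hb]
    refine le_of_forall_pos_le_add fun η hη => ?_
    set b := (α : Measure (Euc d)).real B
    -- first-order upper bounds along the perturbation, uniform over the finitely many `k`
    choose t₀ ht₀ hup using fun k => (hP k).exists_OT_perturb_le hε (ha k) hα hb y
      (half_pos hη)
    set Λ := ε * (b⁻¹ + gibbs ε h h (y, y))
    have hΛ : 0 < Λ := mul_pos hε (add_pos (inv_pos.2 hb) (gibbs_pos _ _ _))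
    have hne : (Finset.univ : Finset (Fin K)).Nonempty := by
      by_contra hcon
      rw [Finset.not_nonempty_iff_eq_empty] at hcon
      rw [hcon] at hw1
      simp at hw1
    obtain ⟨t, ht, htk, htb, htΛ⟩ : ∃ t > 0, (∀ k, t ≤ t₀ k) ∧ t ≤ b ∧ t * (c * Λ) ≤ η := by
      refine ⟨min (Finset.univ.inf' hne t₀) (min b (η / (c * Λ + 1))), ?_, fun k => ?_, ?_, ?_⟩
      · refine lt_min ((Finset.lt_inf'_iff hne).2 fun k _ => ht₀ k) (lt_min hb ?_)
        have := mul_nonneg hc hΛ.le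
        positivity
      · exact (min_le_left _ _).trans (Finset.inf'_le _ (Finset.mem_univ k))
      · exact (min_le_right _ _).trans (min_le_left _ _)
      · have h0 := mul_nonneg hc hΛ.le
        have h1 : min (Finset.univ.inf' hne t₀) (min b (η / (c * Λ + 1))) ≤ η / (c * Λ + 1) :=
          (min_le_right _ _).trans (min_le_right _ _)
        calc _ ≤ η / (c * Λ + 1) * (c * Λ) := mul_le_mul_of_nonneg_right h1 h0
          _ = η * (c * Λ / (c * Λ + 1)) := by ring
          _ ≤ η := mul_le_of_le_one_right hη.le (div_le_one_of_le₀ (by linarith) (by linarith))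
    have hprob := isProbabilityMeasure_perturb (α := (α : Measure (Euc d))) (y := y) hB ht.le htb hb
    set β : Prob d := ⟨perturb (α : Measure (Euc d)) B y t, hprob⟩
    have hβ : (β : Measure (Euc d)) = perturb (α : Measure (Euc d)) B y t := rfl
    have hβG := perturb_mem_subGaussian hα hB ht.le hβ
    have hself := hH.le_OT_self_perturb hε hα hB hb y ht.le htb hβ
    have hhβ : ∫ x, h x ∂(β : Measure (Euc d)) = ∫ x, h x ∂(α : Measure (Euc d)) -
        t * (b⁻¹ * ∫ x in B, h x ∂(α : Measure (Euc d))) + t * h y := by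
      rw [hβ]; exact integral_perturb hB ht.le htb hhi
    have h1 : ∀ k, w k * OT ε (a k) β ≤ w k * OT ε (a k) α +
        (t * (w k * g k y) - t * b⁻¹ * (w k * ∫ x in B, g k x ∂(α : Measure (Euc d))) +
          t * (η / 2) * w k) := fun k => by
      have := mul_le_mul_of_nonneg_left (hup k t ht (htk k) β hβ) (hw k)
      refine this.trans (le_of_eq ?_)
      ring
    have h2 := Finset.sum_le_sum fun k (_ : k ∈ Finset.univ) => h1 k
    rw [Finset.sum_add_distrib, Finset.sum_add_distrib, Finset.sum_sub_distrib, ← Finset.mul_sum,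
      ← Finset.mul_sum, ← Finset.mul_sum, hw1, mul_one] at h2
    have h3 := hmin β hβG
    rw [objective, objective, hH.OT_eq hε hα hα] at h3
    have h4 := mul_le_mul_of_nonneg_left hself (div_nonneg hc zero_le_two)
    rw [hhβ] at h4
    have hBint : ∫ x in B, u x ∂(α : Measure (Euc d)) =
        (∑ k, w k * ∫ x in B, g k x ∂(α : Measure (Euc d))) -
          c * ∫ x in B, h x ∂(α : Measure (Euc d)) :=
      integral_combination (fun k => (hgi k).integrableOn) hhi.integrableOn
    have h5 : t * (b⁻¹ * ∫ x in B, u x ∂(α : Measure (Euc d))) ≤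
        t * (u y + η / 2) + t * (t * (c * Λ)) / 2 := by
      rw [hBint, hu]
      have e : c / 2 * (ε * (t ^ 2 * (b⁻¹ + gibbs ε h h (y, y)))) = t * (t * (c * Λ)) / 2 := by
        simp only [Λ]; ring
      rw [mul_sub, e] at h4
      linarith
    have h6 : t * (b⁻¹ * ∫ x in B, u x ∂(α : Measure (Euc d))) ≤ t * (u y + η) := by
      have := mul_le_mul_of_nonneg_left htΛ ht.le
      linarith
    exact le_of_mul_le_mul_left h6 ht
  refine le_of_tendsto_of_tendsto' (tendsto_setIntegral_closedBall hui) ?_ hball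
  have := (tendsto_setIntegral_closedBall (μ := (α : Measure (Euc d)))
    (integrable_const (1 : ℝ))).mul_const (u y)
  simpa using this

/-- Minimality of the objective is equivalent to the variational inequality, for every choice of
potentials. -/
lemma objective_min_iff_pairing {K : ℕ} (hε : 0 < ε) {c : ℝ} (hc : 0 ≤ c) {w : Fin K → ℝ}
    (hw : ∀ k, 0 ≤ w k) (hw1 : ∑ k, w k = 1) {a : Fin K → Prob d}
    (ha : ∀ k, a k ∈ subGaussian d) {α : Prob d}
    (hα : α ∈ subGaussian d) {f g : Fin K → Euc d → ℝ} {h : Euc d → ℝ}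
    (hP : ∀ k, Potentials ε (a k) α (f k) (g k)) (hH : Potentials ε α α h h) :
    (∀ β ∈ subGaussian d, objective ε c w a α ≤ objective ε c w a β) ↔
      NonnegPairing (fun x => (∑ k, w k * g k x) - c * h x) α := by
  have hint : ∀ β ∈ subGaussian d, Integrable (fun x => (∑ k, w k * g k x) - c * h x)
      (β : Measure (Euc d)) := fun β hβ =>
    (integrable_finsetSum _ fun k _ => ((hP k).integrable_right hβ).const_mul _).sub
      ((hH.integrable_left hβ).const_mul c)
  constructor
  · intro hmin
    refine ⟨hint α hα, fun β hβ => ⟨hint β hβ, sub_nonneg.2 ?_⟩⟩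
    have hpt := integral_le_of_objective_le hε hc hw hw1 ha hα hP hH hmin
    have := integral_mono (integrable_const _) (hint β hβ) hpt
    simpa only [integral_const, probReal_univ, smul_eq_mul, one_mul] using this
  · intro hpair β hβ
    exact objective_le_of_pairing hε hc hw ha hα hβ hP hH (sub_nonneg.1 (hpair.2 β hβ).2)

lemma isBarycenter_OT_iff {K : ℕ} {w : Fin K → ℝ} {a : Fin K → Prob d} {α : Prob d}
    (hα : α ∈ subGaussian d) : IsBarycenter (OT ε) w a α ↔
      ∀ β ∈ subGaussian d, objective ε 0 w a α ≤ objective ε 0 w a β := by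
  simp only [IsBarycenter, isMinOn_iff, objective, zero_div, zero_mul, sub_zero]
  exact and_iff_right hα

lemma isBarycenter_sinkhornDiv_iff {K : ℕ} {w : Fin K → ℝ} (hw1 : ∑ k, w k = 1)
    {a : Fin K → Prob d} {α : Prob d} (hα : α ∈ subGaussian d) :
    IsBarycenter (sinkhornDiv ε) w a α ↔
      ∀ β ∈ subGaussian d, objective ε 1 w a α ≤ objective ε 1 w a β := by
  have key : ∀ β : Prob d, ∑ k, w k * sinkhornDiv ε (a k) β =
      objective ε 1 w a β - ∑ k, w k * (OT ε (a k) (a k) / 2) := fun β => by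
    have : ∀ k, w k * sinkhornDiv ε (a k) β = w k * OT ε (a k) β -
        w k * (OT ε (a k) (a k) / 2) - w k * (OT ε β β / 2) := fun k => by
      rw [sinkhornDiv]; ring
    simp_rw [this]
    rw [Finset.sum_sub_distrib, Finset.sum_sub_distrib, ← Finset.sum_mul, hw1, objective]
    ring
  simp only [IsBarycenter, isMinOn_iff, key, sub_le_sub_iff_right]
  exact and_iff_right hα

end SinkhornBarycenter

end

theorem mainTheorem6 {d K : ℕ} (ε : ℝ) (hε : 0 < ε)
    (w : Fin K → ℝ) (hw : ∀ k, 0 ≤ w k) (hw1 : ∑ k, w k = 1)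
    (a : Fin K → SinkhornBarycenter.Prob d)
    (ha : ∀ k, a k ∈ SinkhornBarycenter.subGaussian d)
    (α : SinkhornBarycenter.Prob d) (hα : α ∈ SinkhornBarycenter.subGaussian d) :
    (SinkhornBarycenter.IsBarycenter (SinkhornBarycenter.OT ε) w a α ↔
      ∃ f g : Fin K → EuclideanSpace ℝ (Fin d) → ℝ,
        (∀ k, SinkhornBarycenter.SinkhornEqs ε (a k) α (f k) (g k)) ∧
        SinkhornBarycenter.NonnegPairing (fun x => ∑ k, w k * g k x) α) ∧
    (SinkhornBarycenter.IsBarycenter (SinkhornBarycenter.sinkhornDiv ε) w a α ↔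
      ∃ (f g : Fin K → EuclideanSpace ℝ (Fin d) → ℝ) (h : EuclideanSpace ℝ (Fin d) → ℝ),
        (∀ k, SinkhornBarycenter.SinkhornEqs ε (a k) α (f k) (g k)) ∧
        SinkhornBarycenter.AutoSinkhornEq ε α h ∧
        SinkhornBarycenter.NonnegPairing (fun x => (∑ k, w k * g k x) - h x) α) := by
  open SinkhornBarycenter in
  obtain ⟨h₀, hH₀⟩ := exists_symmetric_potential hε hα
  choose f₀ g₀ hP₀ using fun k => exists_potentials hε (ha k) hα
  rw [isBarycenter_OT_iff hα, isBarycenter_sinkhornDiv_iff hw1 hα]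
  have key0 := fun (f g : Fin K → EuclideanSpace ℝ (Fin d) → ℝ)
    (hP : ∀ k, Potentials ε (a k) α (f k) (g k)) =>
      objective_min_iff_pairing hε le_rfl hw hw1 ha hα hP hH₀
  have key1 := fun (f g : Fin K → EuclideanSpace ℝ (Fin d) → ℝ)
    (h : EuclideanSpace ℝ (Fin d) → ℝ) (hP : ∀ k, Potentials ε (a k) α (f k) (g k))
    (hH : Potentials ε α α h h) =>
      objective_min_iff_pairing hε zero_le_one hw hw1 ha hα hP hH
  simp only [zero_mul, sub_zero] at key0
  simp only [one_mul] at key1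
  refine ⟨⟨fun hmin => ⟨f₀, g₀, fun k => (hP₀ k).sinkhornEqs, (key0 f₀ g₀ hP₀).1 hmin⟩, ?_⟩,
    ⟨fun hmin => ⟨f₀, g₀, h₀, fun k => (hP₀ k).sinkhornEqs, hH₀.sinkhornEqs.1,
      (key1 f₀ g₀ h₀ hP₀ hH₀).1 hmin⟩, ?_⟩⟩
  · rintro ⟨f, g, hS, hpair⟩
    exact (key0 f g fun k => (hS k).potentials hε (ha k) hα).2 hpair
  · rintro ⟨f, g, h, hS, hA, hpair⟩
    exact (key1 f g h (fun k => (hS k).potentials hε (ha k) hα)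
      (hA.sinkhornEqs.potentials hε hα hα)).2 hpair
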